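/- Let $\mathcal D$ be a triangulated category, $\Lambda$ a free abelian group of finite rank and $p\colon K(\mathcal D)\to\Lambda$ a surjection. Let $\mathrm{Stab}(\mathcal D)$ be the space, with Bridgeland's topology, of locally finite Bridgeland stability conditions $\sigma=(Z,\mathcal P)$ on $\mathcal D$ whose central charge factors through $p$. Equip it with the geodesic (extended) distance $\tilde d$ of the Riemannian metric pulled back along $(Z,\mathcal P)\mapsto Z$ from a constant metric on $\mathrm{Hom}(\Lambda,\mathbb C)$ given by a real inner product: $\tilde d(\sigma,\tau)$ is the infimum of the lengths of the central charge along the continuous paths from $\sigma$ to $\tau$ in $\mathrm{Stab}(\mathcal D)$ whose central charge is $C^1$. Let $\sigma_n=(Z_n,\mathcal P_n)$ be a Cauchy sequence in $(\mathrm{Stab}(\mathcal D),\tilde d)$. Let $m_{\sigma_n}(E)$ be the mass of $E$, that is, the sum of the $|Z_n|$ of its Harder–Narasimhan factors, and let $\phi_n^{\pm}(E)$ be the maximal and minimal phases of $E$ with respect to $\mathcal P_n$. Define full subcategories of $\mathcal D$ by $$\mathcal K_\sigma=\{E : m_{\sigma_n}(E)\to 0\},\qquad \mathcal P_\infty(\phi)=\{E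 : E=0 \text{ or } \phi_n^{\pm}(E)\to\phi\},$$ and let $\mathcal A=\mathcal P_\infty((0,1])$ be the full subcategory of the objects $E$ that admit a Harder–Narasimhan filtration with factors in $\mathcal P_\infty(\phi_1),\dots,\mathcal P_\infty(\phi_k)$, where $1\ge\phi_1>\dots>\phi_k>0$. Then: 1. If $E\to F\to G\to E[1]$ is a distinguished triangle with $E,F,G\in\mathcal A$, then $F\in\mathcal K_\sigma$ if and only if $E\in\mathcal K_\sigma$ and $G\in\mathcal K_\sigma$. 2. If $\mathcal P_\infty$ is a slicing of $\mathcal D$, then $\mathcal A$ is the heart of a bounded t-structure on $\mathcal D$. 3. $\mathcal K_\sigma$ is a triangulated subcategory of $\mathcal D$. Whenever $\mathcal A$ is the heart of a bounded t-structure $(\mathcal D^{\le n},\mathcal D^{\ge n})_{n\in\mathbb Z}$ on $\mathcal D$, the category $\mathcal A$ is abelian, $\mathcal A\cap\mathcal K_\sigma$ is a Serre subcategory of $\mathcal A$, and the t-structure descends to the Verdier quotient $\mathcal D/\mathcal K_\sigma$: the essential images of $\mathcal D^{\le n}$ and $\mathcal D^{\ge n}$ under the quotient functor form a bounded t-structure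 on $\mathcal D/\mathcal K_\sigma$, whose heart is the essential image of $\mathcal A$. -/

import Mathlib

open CategoryTheory Limits Pretriangulated Triangulated Filter Topology
open scoped ENNReal

universe v u w

namespace DegStab

noncomputable section

section Categories

variable (C : Type u) [Category.{v} C] [Preadditive C] [HasZeroObject C] [HasShift C ℤ]
  [∀ n : ℤ, (shiftFunctor C n).Additive] [Pretriangulated C]

/-- The relations `[Y] = [X] + [Z]`, one for each distinguished triangle `X ⟶ Y ⟶ Z ⟶ X⟦1⟧`. -/
def triangleRelations : Set (FreeAbelianGroup C) :=
  {x | ∃ T ∈ distTriang C,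
    x = FreeAbelianGroup.of T.obj₂ - FreeAbelianGroup.of T.obj₁ - FreeAbelianGroup.of T.obj₃}

/-- The Grothendieck group `K(C)` of a triangulated category. -/
abbrev GrothendieckGroup : Type u :=
  FreeAbelianGroup C ⧸ AddSubgroup.closure (triangleRelations C)

variable {C}

/-- The class `[E]` of an object in the Grothendieck group. -/
def classOf (E : C) : GrothendieckGroup C :=
  QuotientAddGroup.mk (FreeAbelianGroup.of E)

/-- A Harder-Narasimhan filtration of `E` with respect to a family `P` of full subcategories
indexed by phases: a chain `0 = E₀ ⟶ E₁ ⟶ ⋯ ⟶ Eₙ = E` whose successive cones are nonzero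
objects of `P φ₁, …, P φₙ` with `φ₁ > ⋯ > φₙ`. The zero object has the filtration of length `0`. -/
structure HNFiltration (P : ℝ → ObjectProperty C) (E : C) where
  length : ℕ
  obj : Fin (length + 1) → C
  isZero_bot : IsZero (obj 0)
  topIso : obj (Fin.last length) ≅ E
  factor : Fin length → C
  phase : Fin length → ℝ
  strictAnti : StrictAnti phase
  mem : ∀ i, P (phase i) (factor i)
  nonzero : ∀ i, ¬ IsZero (factor i)
  incl : ∀ i : Fin length, obj i.castSucc ⟶ obj i.succ
  proj : ∀ i : Fin length, obj i.succ ⟶ factor i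
  conn : ∀ i : Fin length, factor i ⟶ (obj i.castSucc)⟦(1 : ℤ)⟧
  distinguished : ∀ i, Triangle.mk (incl i) (proj i) (conn i) ∈ distTriang C

/-- For a set `I` of phases, the full subcategory `P(I)` of the objects all of whose
Harder-Narasimhan phases lie in `I`. -/
def phaseInterval (P : ℝ → ObjectProperty C) (I : Set ℝ) : ObjectProperty C :=
  fun E => ∃ F : HNFiltration P E, ∀ i, F.phase i ∈ I

variable (C) in
/-- A slicing of a triangulated category. -/
structure Slicing where
  P : ℝ → ObjectProperty C
  isClosedUnderIsomorphisms : ∀ φ, (P φ).IsClosedUnderIsomorphisms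
  zero_mem : ∀ φ (E : C), IsZero E → P φ E
  biprod_mem : ∀ φ (X Y : C) (b : BinaryBicone X Y), b.IsBilimit → P φ X → P φ Y → P φ b.pt
  shift_iff : ∀ φ (E : C), P (φ + 1) (E⟦(1 : ℤ)⟧) ↔ P φ E
  hom_eq_zero : ∀ φ₁ φ₂, φ₂ < φ₁ → ∀ (E F : C) (f : E ⟶ F), P φ₁ E → P φ₂ F → f = 0
  exists_hn : ∀ E : C, Nonempty (HNFiltration P E)

namespace Slicing

/-- The Harder-Narasimhan filtration of an object; it is unique up to unique isomorphism. -/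
def hn (S : Slicing C) (E : C) : HNFiltration S.P E := (S.exists_hn E).some

/-- The maximal phase `φ⁺(E)`: the largest of the finitely many phases of `E ≠ 0`. -/
def phiPlus (S : Slicing C) (E : C) : ℝ := ⨆ i, (S.hn E).phase i

/-- The minimal phase `φ⁻(E)`: the smallest of the finitely many phases of `E ≠ 0`. -/
def phiMinus (S : Slicing C) (E : C) : ℝ := ⨅ i, (S.hn E).phase i

/-- The generalized metric on slicings. -/
def slicingDist (S T : Slicing C) : ℝ≥0∞ :=
  ⨆ (E : C) (_ : ¬ IsZero E),
    max (ENNReal.ofReal |S.phiPlus E - T.phiPlus E|)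
      (ENNReal.ofReal |S.phiMinus E - T.phiMinus E|)

end Slicing

/-- A morphism of the full subcategory `A` is a strict monomorphism if it is the first morphism
of a distinguished triangle with all vertices in `A`. -/
def IsStrictMono (A : ObjectProperty C) {X Y : C} (f : X ⟶ Y) : Prop :=
  A X ∧ A Y ∧ ∃ (Z : C) (q : Y ⟶ Z) (d : Z ⟶ X⟦(1 : ℤ)⟧),
    A Z ∧ Triangle.mk f q d ∈ distTriang C

/-- The full subcategory `A` (in practice `P((a, b))` with `b - a ≤ 1`, which is quasi-abelian)
has finite length: descending and ascending chains of strict subobjects of an object of `A`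
become stationary. -/
def IsFiniteLength (A : ObjectProperty C) : Prop :=
  ∀ E : C, A E → ∀ (X : ℕ → C) (i : ∀ k, X k ⟶ E), (∀ k, IsStrictMono A (i k)) →
    (∀ j : ∀ k, X (k + 1) ⟶ X k, (∀ k, j k ≫ i k = i (k + 1)) →
      ∃ N, ∀ k ≥ N, IsIso (j k)) ∧
    (∀ j : ∀ k, X k ⟶ X (k + 1), (∀ k, j k ≫ i (k + 1) = i k) →
      ∃ N, ∀ k ≥ N, IsIso (j k))

end Categories

section Stability

variable {C : Type u} [Category.{v} C] [Preadditive C] [HasZeroObject C] [HasShift C ℤ]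
  [∀ n : ℤ, (shiftFunctor C n).Additive] [Pretriangulated C]
  {Λ : Type w} [AddCommGroup Λ]

/-- `Stab(C)`: locally finite Bridgeland stability conditions on `C` whose central charge factors
through `p : K(C) → Λ`. The field `Z` is the induced homomorphism on `Λ`, so the central charge of
an object `E` is `Z (p [E])`. -/
structure StabilityCondition (p : GrothendieckGroup C →+ Λ) where
  slicing : Slicing C
  Z : Λ →+ ℂ
  compatible : ∀ (φ : ℝ) (E : C), slicing.P φ E → ¬ IsZero E →
    ∃ r : ℝ, 0 < r ∧ Z (p (classOf E)) = r * Complex.exp (Complex.I * Real.pi * φ)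
  locallyFinite : ∃ η : ℝ, 0 < η ∧ η < 1 / 2 ∧
    ∀ φ : ℝ, IsFiniteLength (phaseInterval slicing.P (Set.Ioo (φ - η) (φ + η)))

variable {p : GrothendieckGroup C →+ Λ}

namespace StabilityCondition

/-- The mass `m_σ(E)`: the sum of the `|Z|` of the Harder-Narasimhan factors of `E`. -/
def mass (σ : StabilityCondition p) (E : C) : ℝ :=
  ∑ i, ‖σ.Z (p (classOf ((σ.slicing.hn E).factor i)))‖

/-- The generalized norm `‖U‖_σ = sup |U(E)| / |Z(E)|` over the nonzero `σ`-semistable `E`. -/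
def chargeNorm (σ : StabilityCondition p) (U : Λ →+ ℂ) : ℝ≥0∞ :=
  ⨆ (φ : ℝ) (E : C) (_ : σ.slicing.P φ E) (_ : ¬ IsZero E),
    ENNReal.ofReal (‖U (p (classOf E))‖ / ‖σ.Z (p (classOf E))‖)

/-- The basic neighbourhood `B_ε(σ)`. -/
def basicBall (σ : StabilityCondition p) (ε : ℝ) : Set (StabilityCondition p) :=
  {τ | σ.chargeNorm (τ.Z - σ.Z) < ENNReal.ofReal (Real.sin ε) ∧
    σ.slicing.slicingDist τ.slicing < ENNReal.ofReal ε}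

/-- Bridgeland's topology on `Stab(C)`, with basis the `B_ε(σ)` for small `ε`. -/
instance : TopologicalSpace (StabilityCondition p) :=
  TopologicalSpace.generateFrom
    {U | ∃ (σ : StabilityCondition p) (ε : ℝ), 0 < ε ∧ ε < 1 / 4 ∧ U = σ.basicBall ε}

/-- The geodesic distance on `Stab(C)` of the pullback, along the forgetful map `σ ↦ Z`, of the
constant Riemannian metric on `Hom(Λ, ℂ)` given by the real inner product `g`: the infimum of the
`g`-lengths of the central charge along continuous paths in `Stab(C)` with `C¹` central charge. -/
def geodesicDist (g : InnerProductSpace.Core ℝ (Λ →+ ℂ)) (σ τ : StabilityCondition p) : ℝ≥0∞ :=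
  letI : NormedAddCommGroup (Λ →+ ℂ) := g.toNormedAddCommGroup
  letI : InnerProductSpace ℝ (Λ →+ ℂ) := InnerProductSpace.ofCore g.toCore
  ⨅ (γ : ℝ → StabilityCondition p) (_ : ContinuousOn γ (Set.Icc 0 1)) (_ : γ 0 = σ) (_ : γ 1 = τ)
    (_ : ContDiffOn ℝ 1 (fun t => (γ t).Z) (Set.Icc 0 1)),
    ∫⁻ t in Set.Icc (0 : ℝ) 1, ‖derivWithin (fun t => (γ t).Z) (Set.Icc 0 1) t‖ₑ

end StabilityCondition

/-- Cauchy sequences in `Stab(C)` for the geodesic distance of the pullback metric. -/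
def IsCauchySequence (g : InnerProductSpace.Core ℝ (Λ →+ ℂ)) (σ : ℕ → StabilityCondition p) :
    Prop :=
  ∀ ε : ℝ≥0∞, 0 < ε → ∃ N, ∀ m ≥ N, ∀ n ≥ N, (σ m).geodesicDist g (σ n) < ε

/-- The full subcategory `K_σ` of the objects whose mass tends to zero. -/
def massless (σ : ℕ → StabilityCondition p) : ObjectProperty C :=
  fun E => Tendsto (fun n => (σ n).mass E) atTop (𝓝 0)

/-- The full subcategories `P_∞(φ)` of the objects all of whose phases tend to `φ`. The zero object,
which has no phases, belongs to all of them. -/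
def limitPhase (σ : ℕ → StabilityCondition p) (φ : ℝ) : ObjectProperty C :=
  fun E => IsZero E ∨
    (Tendsto (fun n => (σ n).slicing.phiPlus E) atTop (𝓝 φ) ∧
      Tendsto (fun n => (σ n).slicing.phiMinus E) atTop (𝓝 φ))

/-- The limiting heart `A = P_∞((0, 1])`. -/
def limitHeart (σ : ℕ → StabilityCondition p) : ObjectProperty C :=
  phaseInterval (limitPhase σ) (Set.Ioc 0 1)

end Stability

section Descent

variable {C : Type u} [Category.{v} C] [Preadditive C] [HasZeroObject C] [HasShift C ℤ]
  [∀ n : ℤ, (shiftFunctor C n).Additive] [Pretriangulated C]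

/-- A t-structure is bounded if every object is bounded above and below. -/
def IsBoundedTStructure (t : TStructure C) : Prop := ∀ E : C, t.bounded E

variable [IsTriangulated C]

/-- The Verdier quotient `C/K`: the localization of `C` at the morphisms with cone in `K`, with its
triangulated structure. -/
abbrev VerdierQuotient (K : ObjectProperty C) [K.IsTriangulated] : Type _ := K.trW.Localization

/-- The t-structure `t` on `C` descends to the t-structure `t'` on `C/K`: the subcategories defining
`t'` are the essential images of those defining `t` under the quotient functor. -/
def DescendsTo (t : TStructure C) (K : ObjectProperty C) [K.IsTriangulated]
    (t' : TStructure (VerdierQuotient K)) : Prop :=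
  ∀ n : ℤ, t'.le n = (t.le n).map K.trW.Q ∧ t'.ge n = (t.ge n).map K.trW.Q

end Descent

end

end DegStab

/-! Masses are controlled by functions additive on triangles. For real `a`, the phases in `(a, a +
1]` span the heart of a bounded t-structure on which `W = Im (e^{-iπa} Z)` is nonnegative. The total
value of such a `W` on cohomology objects is subadditive on triangles, since the connecting maps of
the long exact sequence only cancel (`cohValue_le`). This total is the sum of `|W|` over the
Harder–Narasimhan factors (`hasSum_cohValue`), and two angles `a` bound the mass up to a constant.
So `m(F) ≤ 2 (m(E) + m(G))`, and the massless objects form a triangulated subcategory.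

An object of the limiting heart has, for large `n`, all its phases in `(δ, 1 + ε)` with `δ` fixed
and `ε` as small as desired. A small rotation puts them in a sector strictly inside the upper half
plane, where mass is comparable to an additive function; this gives the two-out-of-three statement
(`massless_of_heart`). The same gap separates the phases of the two ends of a truncation triangle,
so truncations of massless objects are massless (`massless_of_truncation`).

Stability of the massless objects under truncation and under quotients in the heart is what makes
the t-structure descend (`exists_isLE`, `quotient_hom_eq_zero`). -/

namespace DegStab

open scoped ZeroObject

/-! ### Calculus of extensions in a triangulated category. -/

section Triangles

variable {C : Type u} [Category.{v} C] [Preadditive C] [HasZeroObject C] [HasShift C ℤ]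
  [∀ n : ℤ, (shiftFunctor C n).Additive] [Pretriangulated C]

/-- `Y` is an extension of `Z` by `X`: there is a distinguished triangle `X ⟶ Y ⟶ Z ⟶ X⟦1⟧`. -/
def IsExtension (X Y Z : C) : Prop :=
  ∃ (f : X ⟶ Y) (g : Y ⟶ Z) (h : Z ⟶ X⟦(1 : ℤ)⟧), Triangle.mk f g h ∈ distTriang C

namespace IsExtension

lemma of_distTriang {T : Triangle C} (hT : T ∈ distTriang C) :
    IsExtension T.obj₁ T.obj₂ T.obj₃ := ⟨T.mor₁, T.mor₂, T.mor₃, hT⟩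

lemma rotate {X Y Z : C} (h : IsExtension X Y Z) : IsExtension Y Z (X⟦(1 : ℤ)⟧) := by
  obtain ⟨f, g, h, hT⟩ := h
  exact ⟨_, _, _, rot_of_distTriang _ hT⟩

lemma invRotate {X Y Z : C} (h : IsExtension X Y Z) : IsExtension (Z⟦(-1 : ℤ)⟧) X Y := by
  obtain ⟨f, g, h, hT⟩ := h
  exact ⟨_, _, _, inv_rot_of_distTriang _ hT⟩

lemma shift {X Y Z : C} (h : IsExtension X Y Z) (n : ℤ) :
    IsExtension (X⟦n⟧) (Y⟦n⟧) (Z⟦n⟧) := by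
  obtain ⟨f, g, h, hT⟩ := h
  exact ⟨_, _, _, Triangle.shift_distinguished _ hT n⟩

lemma of_isZero_left {X Y Z : C} (hX : IsZero X) (e : Y ≅ Z) : IsExtension X Y Z :=
  ⟨0, e.hom, 0, (Triangle.distinguished_iff_of_isZero₁ (Triangle.mk _ _ _) hX).2
    (inferInstanceAs (IsIso e.hom))⟩

lemma of_isZero_right {X Y Z : C} (hZ : IsZero Z) (e : X ≅ Y) : IsExtension X Y Z :=
  ⟨e.hom, 0, 0, (Triangle.distinguished_iff_of_isZero₃ (Triangle.mk _ _ _) hZ).2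
    (inferInstanceAs (IsIso e.hom))⟩

lemma iso_of_isZero_left {X Y Z : C} (h : IsExtension X Y Z) (hX : IsZero X) :
    Nonempty (Y ≅ Z) := by
  obtain ⟨f, g, h, hT⟩ := h
  have : IsIso g := (Triangle.isZero₁_iff_isIso₂ _ hT).1 hX
  exact ⟨asIso g⟩

lemma congr {X Y Z X' Y' Z' : C} (h : IsExtension X Y Z) (e₁ : X ≅ X') (e₂ : Y ≅ Y')
    (e₃ : Z ≅ Z') : IsExtension X' Y' Z' := by
  obtain ⟨f, g, h, hT⟩ := h
  refine ⟨e₁.inv ≫ f ≫ e₂.hom, e₂.inv ≫ g ≫ e₃.hom, e₃.inv ≫ h ≫ e₁.hom⟦(1 : ℤ)⟧',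
    isomorphic_distinguished _ hT _ (Triangle.isoMk _ _ e₁.symm e₂.symm e₃.symm ?_ ?_ ?_)⟩
  · change (e₁.inv ≫ f ≫ e₂.hom) ≫ e₂.inv = e₁.inv ≫ f
    simp
  · change (e₂.inv ≫ g ≫ e₃.hom) ≫ e₃.inv = e₂.inv ≫ g
    simp
  · change (e₃.inv ≫ h ≫ e₁.hom⟦(1 : ℤ)⟧') ≫ e₁.inv⟦(1 : ℤ)⟧' = e₃.inv ≫ h
    simp

/-- A triangle with zero connecting morphism splits, so the two ends of a biproduct can be
exchanged. -/
lemma swap {X Y Z : C} (h : IsExtension X Y Z) (hz : ∀ f : Z ⟶ X⟦(1 : ℤ)⟧, f = 0) :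
    IsExtension Z Y X := by
  obtain ⟨f, g, h, hT⟩ := h
  obtain ⟨e, -, -⟩ := exists_iso_binaryBiproduct_of_distTriang _ hT (hz h)
  exact congr (of_distTriang (binaryBiproductTriangle_distinguished Z X))
    (Iso.refl Z) (biprod.braiding Z X ≪≫ e.symm) (Iso.refl X)

variable [IsTriangulated C]

/-- The octahedral axiom read as `V/X` being an extension of `V/Y` by `Y/X`; `assoc'` is the dual,
for iterated quotients. -/
lemma assoc {X A Y B V : C} (h₁ : IsExtension X Y A) (h₂ : IsExtension Y V B) :
    ∃ D, IsExtension X V D ∧ IsExtension A D B := by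
  obtain ⟨f, g, h, hT⟩ := h₁
  obtain ⟨f', g', h', hT'⟩ := h₂
  obtain ⟨D, p, q, hD⟩ := distinguished_cocone_triangle (f ≫ f')
  exact ⟨D, ⟨_, _, _, hD⟩, ⟨_, _, _, (someOctahedron rfl hT hT' hD).mem⟩⟩

lemma assoc' {A Y Z B V : C} (h₁ : IsExtension A Y Z) (h₂ : IsExtension B Z V) :
    ∃ D, IsExtension D Y V ∧ IsExtension A D B := by
  obtain ⟨f, g, h, hT⟩ := h₁
  obtain ⟨f', g', h', hT'⟩ := h₂
  obtain ⟨D, p, q, hD⟩ := distinguished_cocone_triangle₁ (g ≫ g')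
  exact ⟨D, ⟨_, _, _, hD⟩, ⟨_, _, _, (someOctahedron' rfl hT hT' hD).mem⟩⟩

end IsExtension

end Triangles

/-! ### Truncation triangles and induction on cohomological range. -/

section TStructures

variable {C : Type u} [Category.{v} C] [Preadditive C] [HasZeroObject C] [HasShift C ℤ]
  [∀ n : ℤ, (shiftFunctor C n).Additive] [Pretriangulated C] (t : TStructure C)

namespace IsExtension

variable {t}

lemma isLE_mid {X Y Z : C} (h : IsExtension X Y Z) {n : ℤ} (hX : t.IsLE X n)
    (hZ : t.IsLE Z n) : t.IsLE Y n := by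
  obtain ⟨_, _, _, hT⟩ := h
  exact t.isLE₂ _ hT n hX hZ

lemma isGE_mid {X Y Z : C} (h : IsExtension X Y Z) {n : ℤ} (hX : t.IsGE X n)
    (hZ : t.IsGE Z n) : t.IsGE Y n := by
  obtain ⟨_, _, _, hT⟩ := h
  exact t.isGE₂ _ hT n hX hZ

lemma isGE_left {X Y Z : C} (h : IsExtension X Y Z) {n : ℤ} (hY : t.IsGE Y n)
    (hZ : t.IsGE Z (n - 1)) : t.IsGE X n :=
  h.invRotate.isGE_mid (t.isGE_shift Z (n - 1) (-1) n) hY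

end IsExtension

lemma isExtension_trunc (X : C) (n : ℤ) :
    IsExtension ((t.truncLT n).obj X) X ((t.truncGE n).obj X) :=
  .of_distTriang (t.triangleLTGE_distinguished n X)

/-- Induction along the truncations of an object with cohomology in the range `[a, b]`. -/
lemma tStructure_induction [IsTriangulated C] {Φ : C → Prop} (a b : ℤ)
    (zero : ∀ X, IsZero X → Φ X)
    (step : ∀ X Y Z k, a ≤ k → k ≤ b → IsExtension X Y Z → t.IsLE X (k - 1) →
      t.IsLE Z k → t.IsGE Z k → Φ X → Φ Y) (X : C) [t.IsGE X a] [t.IsLE X b] : Φ X := by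
  -- `n` bounds the number of degrees in `[a, b']`; each step removes the top cohomology object.
  suffices H : ∀ (n : ℕ) (b' : ℤ), b' ≤ b → b' < a + n → ∀ Y : C, t.IsGE Y a → t.IsLE Y b' → Φ Y from
    H (b - a + 1).toNat b le_rfl (by lia) X inferInstance inferInstance
  intro n
  induction n with
  | zero => exact fun b' _ h Y _ _ ↦ zero Y (t.isZero Y b' a (by lia))
  | succ n ih =>
    intro b' hb h Y hY hY'
    by_cases hab : a ≤ b'
    · exact step _ _ _ b' hab hb (isExtension_trunc t Y b') inferInstance inferInstance inferInstance
        (ih (b' - 1) (by lia) (by lia) _ inferInstance inferInstance)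
    · exact zero Y (t.isZero Y b' a (by lia))

lemma isExtension_trunc_iso {X Y Z : C} (h : IsExtension X Y Z) (n : ℤ) (hX : t.IsLE X (n - 1))
    (hZ : t.IsGE Z n) :
    Nonempty (X ≅ (t.truncLT n).obj Y) ∧ Nonempty (Z ≅ (t.truncGE n).obj Y) := by
  obtain ⟨f, g, h, hT⟩ := h
  obtain ⟨e, -⟩ := t.triangle_iso_exists hT (t.triangleLTGE_distinguished n Y) (Iso.refl _)
    (n - 1) n hX hZ inferInstance inferInstance
  exact ⟨⟨Triangle.π₁.mapIso e⟩, ⟨Triangle.π₃.mapIso e⟩⟩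

end TStructures

/-! ### Additive functions on triangles and their values on cohomology objects. -/

section AdditiveFunctions

variable {C : Type u} [Category.{v} C] [Preadditive C] [HasZeroObject C] [HasShift C ℤ]
  [∀ n : ℤ, (shiftFunctor C n).Additive] [Pretriangulated C]

/-- A real function on objects, additive on distinguished triangles. -/
def IsAdditiveFunction (W : C → ℝ) : Prop :=
  ∀ X Y Z : C, IsExtension X Y Z → W Y = W X + W Z

namespace IsAdditiveFunction

variable {W : C → ℝ} (hW : IsAdditiveFunction W)

include hW

lemma isZero {X : C} (hX : IsZero X) : W X = 0 := by
  have := hW X X X (.of_isZero_left hX (Iso.refl X))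
  linarith

lemma iso {X Y : C} (e : X ≅ Y) : W X = W Y := by
  have := hW _ X Y (.of_isZero_left (isZero_zero C) e)
  rw [this, hW.isZero (isZero_zero C), zero_add]

lemma shift_one (X : C) : W (X⟦(1 : ℤ)⟧) = - W X := by
  have h := hW _ _ _ (IsExtension.of_distTriang (T := Triangle.mk (𝟙 X) (0 : X ⟶ 0) 0)
    (contractible_distinguished X)).rotate
  have h' : W (0 : C) = 0 := hW.isZero (isZero_zero C)
  change W (0 : C) = W X + W (X⟦(1 : ℤ)⟧) at h
  linarith

lemma shift (X : C) (n : ℤ) : W (X⟦n⟧) = (n.negOnePow : ℤ) * W X := by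
  have key (m : ℤ) : W (X⟦m + 1⟧) = - W (X⟦m⟧) := by
    rw [hW.iso ((shiftFunctorAdd' C m 1 (m + 1) rfl).app X), ← hW.shift_one]; rfl
  induction n using Int.induction_on with
  | zero => simpa using hW.iso ((shiftFunctorZero C ℤ).app X)
  | succ i hi => rw [key, hi, Int.negOnePow_succ]; simp
  | pred i hi =>
    have := key (-i - 1)
    rw [sub_add_cancel, hi] at this
    rw [Int.negOnePow_sub, Int.negOnePow_one, mul_neg_one, Units.val_neg]
    push_cast
    linarith

end IsAdditiveFunction

variable (t : TStructure C)

/-- The value of `W` on the truncation `τ^{<n} X`. -/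
noncomputable def truncValue (W : C → ℝ) (n : ℤ) (X : C) : ℝ := W ((t.truncLT n).obj X)

/-- The value of `W` on the `n`-th cohomology object of `X`. -/
noncomputable def cohValue (W : C → ℝ) (n : ℤ) (X : C) : ℝ :=
  (n.negOnePow : ℤ) * (truncValue t W (n + 1) X - truncValue t W n X)

section

variable {t} {W : C → ℝ} (hW : IsAdditiveFunction W)

include hW

lemma truncValue_eq {X Y Z : C} (h : IsExtension X Y Z) (n : ℤ) (hX : t.IsLE X (n - 1))
    (hZ : t.IsGE Z n) : truncValue t W n Y = W X := by
  obtain ⟨⟨e⟩, -⟩ := isExtension_trunc_iso t h n hX hZ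
  exact (hW.iso e).symm

lemma truncValue_of_isLE {X : C} (n : ℤ) (hX : t.IsLE X (n - 1)) : truncValue t W n X = W X :=
  truncValue_eq hW (.of_isZero_right (isZero_zero C) (Iso.refl X)) n hX inferInstance

lemma truncValue_of_isGE {X : C} (n : ℤ) (hX : t.IsGE X n) : truncValue t W n X = 0 := by
  rw [truncValue_eq hW (.of_isZero_left (isZero_zero C) (Iso.refl X)) n inferInstance hX,
    hW.isZero (isZero_zero C)]

lemma truncValue_shift (X : C) (n a : ℤ) :
    truncValue t W n (X⟦a⟧) = (a.negOnePow : ℤ) * truncValue t W (n + a) X := by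
  rw [truncValue_eq hW ((isExtension_trunc t X (n + a)).shift a) n, hW.shift, truncValue]
  · exact t.isLE_shift _ (n + a - 1) a (n - 1)
  · exact t.isGE_shift _ (n + a) a n

lemma cohValue_shift (X : C) (n a : ℤ) :
    cohValue t W n (X⟦a⟧) = cohValue t W (n + a) X := by
  simp only [cohValue, truncValue_shift hW, Int.negOnePow_add, add_right_comm n 1 a]
  push_cast
  ring

lemma cohValue_of_heart {X : C} (k : ℤ) (hX : t.IsLE X k) (hX' : t.IsGE X k) (n : ℤ) :
    cohValue t W n X = if n = k then (k.negOnePow : ℤ) * W X else 0 := by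
  have h₁ (m : ℤ) (hm : k < m) : truncValue t W m X = W X :=
    truncValue_of_isLE hW m (t.isLE_of_le X k _)
  have h₂ (m : ℤ) (hm : m ≤ k) : truncValue t W m X = 0 :=
    truncValue_of_isGE hW m (t.isGE_of_ge X _ k)
  rw [cohValue]
  split_ifs with h
  · rw [h₁ _ (by lia), h₂ _ (by lia), h]; simp
  · rcases lt_or_gt_of_ne h with h | h
    · rw [h₂ _ (by lia), h₂ _ (by lia)]; simp
    · rw [h₁ _ (by lia), h₁ _ (by lia)]; simp

lemma cohValue_isZero {X : C} (hX : IsZero X) (n : ℤ) : cohValue t W n X = 0 := by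
  have := t.isLE_of_isZero hX 0
  have := t.isGE_of_isZero hX 0
  rw [cohValue_of_heart hW 0 inferInstance inferInstance, hW.isZero hX]
  simp

lemma cohValue_iso {X Y : C} (e : X ≅ Y) (n : ℤ) : cohValue t W n X = cohValue t W n Y := by
  simp only [cohValue, truncValue, hW.iso ((t.truncLT _).mapIso e)]

/-- The degrees of `X` and `Z` overlap at most in `k`, so all connecting maps in cohomology vanish.
Truncating below `m ≤ k` affects only `X`, and below `m > k` only `Z`. -/
lemma cohValue_add [IsTriangulated C] {X Y Z : C} (h : IsExtension X Y Z) (k : ℤ)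
    (hX : t.IsLE X k) (hZ : t.IsGE Z k) (n : ℤ) :
    cohValue t W n Y = cohValue t W n X + cohValue t W n Z := by
  have H (m : ℤ) : truncValue t W m Y = truncValue t W m X + truncValue t W m Z := by
    rcases le_or_gt m k with hm | hm
    · have hZ' : t.IsGE Z m := t.isGE_of_ge Z m k
      rw [truncValue_of_isGE hW m hZ', add_zero]
      obtain ⟨D, h₁, h₂⟩ := (isExtension_trunc t X m).assoc h
      exact truncValue_eq hW h₁ m inferInstance (h₂.isGE_mid inferInstance hZ')
    · have hX' : t.IsLE X (m - 1) := t.isLE_of_le X k _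
      obtain ⟨D, h₁, h₂⟩ := h.assoc' (isExtension_trunc t Z m)
      rw [truncValue_eq hW h₁ m (h₂.isLE_mid hX' inferInstance) inferInstance, hW _ _ _ h₂,
        truncValue_of_isLE hW m hX', truncValue]
  rw [cohValue, cohValue, cohValue, H, H]
  ring

variable (hpos : ∀ X, t.heart X → 0 ≤ W X)

include hpos

lemma negOnePow_mul_nonneg {X : C} (k : ℤ) (hX : t.IsLE X k) (hX' : t.IsGE X k) :
    0 ≤ (k.negOnePow : ℤ) * W X := by
  rw [← hW.shift X k]
  exact hpos _ ((t.mem_heart_iff _).2 ⟨t.isLE_shift X k k 0, t.isGE_shift X k k 0⟩)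

variable [IsTriangulated C]

lemma cohValue_nonneg (X : C) (n : ℤ) : 0 ≤ cohValue t W n X := by
  have h₁ : cohValue t W n ((t.truncLT n).obj X) = 0 := by
    rw [cohValue, truncValue_of_isLE hW (n + 1) (t.isLE_of_le _ (n - 1) _),
      truncValue_of_isLE hW n inferInstance]; simp
  have h₂ : cohValue t W n ((t.truncGE (n + 1)).obj ((t.truncGE n).obj X)) = 0 := by
    rw [cohValue, truncValue_of_isGE hW (n + 1) inferInstance,
      truncValue_of_isGE hW n (t.isGE_of_ge _ _ (n + 1))]; simp
  rw [cohValue_add hW (isExtension_trunc t X n) n (t.isLE_of_le _ (n - 1) n) inferInstance,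
    cohValue_add hW (isExtension_trunc t ((t.truncGE n).obj X) (n + 1)) n inferInstance
      (t.isGE_of_ge _ _ (n + 1)), h₁, h₂, cohValue_of_heart hW n inferInstance inferInstance n,
    if_pos rfl, zero_add, add_zero]
  exact negOnePow_mul_nonneg hW hpos n inferInstance inferInstance

/-- The one case with a genuine connecting map, `H^{k-1}(B) ⟶ H^k(E)`. Its image `I` is lost from
both sides: `K` is the kernel and `Q` the cokernel, and the signed value of `I` is nonnegative. -/
lemma cohValue_cone_le {E M B : C} (h : IsExtension E M B) (k : ℤ) (hE : t.IsLE E k)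
    (hE' : t.IsGE E k) (hB : t.IsLE B (k - 1)) (hB' : t.IsGE B (k - 1)) (n : ℤ) :
    cohValue t W n M ≤ cohValue t W n E + cohValue t W n B := by
  have hM : t.IsLE M k := h.isLE_mid hE (t.isLE_of_le B (k - 1) k)
  have hM' : t.IsGE M (k - 1) := h.isGE_mid (t.isGE_of_ge E (k - 1) k) hB'
  have hKQ := isExtension_trunc t M k
  set K := (t.truncLT k).obj M
  set Q := (t.truncGE k).obj M
  have hK : t.IsLE K (k - 1) := inferInstanceAs (t.IsLE ((t.truncLT k).obj M) (k - 1))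
  have hK' : t.IsGE K (k - 1) := inferInstanceAs (t.IsGE ((t.truncLT k).obj M) (k - 1))
  have hQ : t.IsLE Q k := inferInstanceAs (t.IsLE ((t.truncGE k).obj M) k)
  have hQ' : t.IsGE Q k := inferInstanceAs (t.IsGE ((t.truncGE k).obj M) k)
  obtain ⟨I, h₁, h₂⟩ := h.invRotate.assoc' hKQ
  have hI : t.IsLE I k := h₂.isLE_mid (t.isLE_shift B (k - 1) (-1) k) (t.isLE_of_le K (k - 1) k)
  have hI' : t.IsGE I k := h₁.isGE_left hE' (t.isGE_of_ge Q (k - 1) k)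
  have pos := negOnePow_mul_nonneg hW hpos k hI hI'
  have e₁ := hW _ _ _ h₁
  have e₂ := hW _ _ _ h
  have e₃ := hW _ _ _ hKQ
  rw [cohValue_add hW hKQ k (t.isLE_of_le K (k - 1) k) hQ', cohValue_of_heart hW k hE hE',
    cohValue_of_heart hW k hQ hQ', cohValue_of_heart hW (k - 1) hB hB',
    cohValue_of_heart hW (k - 1) hK hK']
  have e₄ : W Q = W E - W I := by linarith
  have e₅ : W K = W B + W I := by linarith
  rw [e₄, e₅, Int.negOnePow_sub, Int.negOnePow_one]
  push_cast
  split_ifs <;> nlinarith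

/-- With `E` in degree `k`, only `H^{k-1}(G)` can interact with it. The part of `G` in degrees `≥ k`
is split off on the right, and the part in degrees `≤ k - 2` on the left because it has no morphisms
to `E⟦1⟧`. -/
lemma cohValue_le_of_heart {E F G : C} (h : IsExtension E F G) (k : ℤ) (hE : t.IsLE E k)
    (hE' : t.IsGE E k) (n : ℤ) :
    cohValue t W n F ≤ cohValue t W n E + cohValue t W n G := by
  have hG := isExtension_trunc t G k
  have hG₁ := isExtension_trunc t ((t.truncLT k).obj G) (k - 1)
  obtain ⟨F₁, hF, hF₁⟩ := h.assoc' hG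
  obtain ⟨Y, hF₁', hY⟩ := hF₁.assoc' hG₁
  have hY' := hY.swap (fun f ↦ t.zero_of_isLE_of_isGE f (k - 2) (k - 1) (by lia)
    (t.isLE_of_le _ (k - 1 - 1) _) (t.isGE_shift E k 1 (k - 1)))
  obtain ⟨M, hM₁, hM⟩ := hY'.assoc hF₁'
  have hM' := hM.isGE_mid (t.isGE_of_ge E (k - 1) k) inferInstance
  rw [cohValue_add hW hF k (hF₁.isLE_mid hE (t.isLE_of_le _ (k - 1) k)) inferInstance,
    cohValue_add hW hM₁ (k - 1) (t.isLE_of_le _ (k - 1 - 1) _) hM',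
    cohValue_add hW hG k (t.isLE_of_le _ (k - 1) k) inferInstance,
    cohValue_add hW hG₁ (k - 1) (t.isLE_of_le _ (k - 1 - 1) _) inferInstance]
  have := cohValue_cone_le hW hpos hM k hE hE' inferInstance inferInstance n
  linarith

lemma cohValue_le (ht : IsBoundedTStructure t) {E F G : C} (h : IsExtension E F G) (n : ℤ) :
    cohValue t W n F ≤ cohValue t W n E + cohValue t W n G := by
  obtain ⟨⟨a, ha⟩, ⟨b, hb⟩⟩ := ht E
  refine tStructure_induction t (Φ := fun E ↦ ∀ F G, IsExtension E F G →
    cohValue t W n F ≤ cohValue t W n E + cohValue t W n G) a b ?_ ?_ E F G h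
  · intro E hE F G h
    obtain ⟨e⟩ := h.iso_of_isZero_left hE
    rw [cohValue_isZero hW hE, zero_add, cohValue_iso hW e]
  · intro X Y Z k _ _ h hX hZ hZ' ih F G hF
    obtain ⟨D, h₁, h₂⟩ := h.assoc hF
    have := ih _ _ h₁
    have := cohValue_le_of_heart hW hpos h₂ k hZ hZ' n
    rw [cohValue_add hW h k (t.isLE_of_le X (k - 1) k) hZ']
    linarith

end

end AdditiveFunctions

/-! ### Slicings, phase bounds through extension closures, and the associated t-structures. -/

section Slicings

variable {C : Type u} [Category.{v} C] [Preadditive C] [HasZeroObject C] [HasShift C ℤ]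
  [∀ n : ℤ, (shiftFunctor C n).Additive] [Pretriangulated C]

/-- The smallest full subcategory containing zero objects and the objects satisfying `P`, and closed
under extensions. -/
inductive ExtClosure (P : C → Prop) : C → Prop
  | zero {X : C} : IsZero X → ExtClosure P X
  | of {X : C} : P X → ExtClosure P X
  | ext {X Y Z : C} : IsExtension X Y Z → ExtClosure P X → ExtClosure P Z → ExtClosure P Y

namespace ExtClosure

variable {P Q : C → Prop}

lemma iso {X Y : C} (h : ExtClosure P X) (e : X ≅ Y) : ExtClosure P Y :=
  .ext (.of_isZero_right (isZero_zero C) e) h (.zero (isZero_zero C))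

lemma mono {X : C} (h : ExtClosure P X) (hPQ : ∀ X, P X → Q X) : ExtClosure Q X := by
  induction h with
  | zero h => exact .zero h
  | of h => exact .of (hPQ _ h)
  | ext h _ _ h₁ h₂ => exact .ext h h₁ h₂

lemma hom_eq_zero (H : ∀ X Y, P X → Q Y → ∀ f : X ⟶ Y, f = 0) {X Y : C} (hX : ExtClosure P X)
    (hY : ExtClosure Q Y) (f : X ⟶ Y) : f = 0 := by
  induction hX generalizing Y with
  | zero h => exact h.eq_of_src _ _
  | of h =>
    induction hY with
    | zero h => exact h.eq_of_tgt _ _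
    | of h' => exact H _ _ h h' f
    | ext h _ _ h₁ h₂ =>
      obtain ⟨a, b, c, hT⟩ := h
      obtain ⟨g, rfl⟩ := Triangle.coyoneda_exact₂ _ hT f (h₂ _)
      rw [h₁ g]
      exact zero_comp
  | ext h _ _ h₁ h₂ =>
    obtain ⟨a, b, c, hT⟩ := h
    obtain ⟨g, rfl⟩ := Triangle.yoneda_exact₂ _ hT f (h₁ hY _)
    rw [h₂ hY g]
    exact comp_zero

lemma shift (n : ℤ) (H : ∀ X, P X → Q (X⟦n⟧)) {X : C} (hX : ExtClosure P X) :
    ExtClosure Q (X⟦n⟧) := by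
  induction hX with
  | zero h => exact .zero ((shiftFunctor C n).map_isZero h)
  | of h => exact .of (H _ h)
  | ext h _ _ h₁ h₂ => exact .ext (h.shift n) h₁ h₂

end ExtClosure

namespace Slicing

variable (S : Slicing C)

/-- The extension closure of the semistable objects with phase in `I`. -/
def ext (I : Set ℝ) : C → Prop := ExtClosure (fun E ↦ ∃ φ ∈ I, S.P φ E)

variable {S}

lemma ext_mono {I J : Set ℝ} (h : I ⊆ J) {E : C} (hE : S.ext I E) : S.ext J E :=
  ExtClosure.mono hE (fun _ ⟨φ, hφ, hX⟩ ↦ ⟨φ, h hφ, hX⟩)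

lemma ext_hom_eq_zero {I J : Set ℝ} (h : ∀ x ∈ I, ∀ y ∈ J, y < x) {E F : C} (hE : S.ext I E)
    (hF : S.ext J F) (f : E ⟶ F) : f = 0 :=
  ExtClosure.hom_eq_zero (fun _ _ ⟨φ, hφ, hX⟩ ⟨ψ, hψ, hY⟩ f ↦
    S.hom_eq_zero φ ψ (h _ hφ _ hψ) _ _ f hX hY) hE hF f

lemma P_iso {φ : ℝ} {E F : C} (e : E ≅ F) (h : S.P φ E) : S.P φ F :=
  (S.isClosedUnderIsomorphisms φ).of_iso e h

lemma P_shift {φ : ℝ} {E : C} (h : S.P φ E) (n : ℤ) : S.P (φ + n) (E⟦n⟧) := by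
  have key (m : ℤ) : S.P (φ + m + 1) (E⟦m + 1⟧) ↔ S.P (φ + m) (E⟦m⟧) := by
    rw [← S.shift_iff (φ + m) (E⟦m⟧)]
    exact ⟨fun h ↦ P_iso ((shiftFunctorAdd' C m 1 (m + 1) rfl).app E) h,
      fun h ↦ P_iso ((shiftFunctorAdd' C m 1 (m + 1) rfl).symm.app E) h⟩
  induction n using Int.induction_on with
  | zero => simpa using P_iso ((shiftFunctorZero C ℤ).symm.app E) h
  | succ i hi =>
    have := (key i).2 hi
    push_cast at this ⊢
    rwa [← add_assoc]
  | pred i hi =>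
    have := (key (-i - 1))
    rw [sub_add_cancel] at this
    refine this.1 ?_
    push_cast at hi ⊢
    convert hi using 1
    ring

lemma ext_shift {I J : Set ℝ} (n : ℤ) (h : ∀ x ∈ I, x + n ∈ J) {E : C} (hE : S.ext I E) :
    S.ext J (E⟦n⟧) :=
  ExtClosure.shift n (fun _ ⟨φ, hφ, hX⟩ ↦ ⟨φ + n, h _ hφ, P_shift hX n⟩) hE

end Slicing

namespace HNFiltration

variable {S : Slicing C} {P : ℝ → ObjectProperty C} {E : C}

/-- Induction along a Harder-Narasimhan filtration. -/
lemma induction (F : HNFiltration P E) {Φ : Fin (F.length + 1) → C → Prop}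
    (zero : ∀ X, IsZero X → Φ 0 X)
    (step : ∀ (i : Fin F.length) (X Y : C), IsExtension X Y (F.factor i) → Φ i.castSucc X →
      Φ i.succ Y) (iso : ∀ i X Y, (X ≅ Y) → Φ i X → Φ i Y) : Φ (Fin.last _) E := by
  have H (i : Fin (F.length + 1)) : Φ i (F.obj i) := by
    induction i using Fin.induction with
    | zero => exact zero _ F.isZero_bot
    | succ i hi => exact step i _ _ (.of_distTriang (F.distinguished i)) hi
  exact iso _ _ _ F.topIso (H _)

lemma ext_obj (F : HNFiltration S.P E) (i : Fin (F.length + 1)) :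
    S.ext (F.phase '' {j | j.castSucc < i}) (F.obj i) := by
  induction i using Fin.induction with
  | zero => exact .zero F.isZero_bot
  | succ i hi =>
    refine .ext (.of_distTriang (F.distinguished i)) (Slicing.ext_mono ?_ hi)
      (.of ⟨F.phase i, ⟨i, Fin.castSucc_lt_succ, rfl⟩, F.mem i⟩)
    exact Set.image_mono fun j hj ↦ lt_trans hj Fin.castSucc_lt_succ

lemma ext_obj_castSucc (F : HNFiltration S.P E) (i : Fin F.length) :
    S.ext (Set.Ioi (F.phase i)) (F.obj i.castSucc) := by
  refine Slicing.ext_mono ?_ (F.ext_obj i.castSucc)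
  rintro _ ⟨j, hj, rfl⟩
  exact F.strictAnti (Fin.castSucc_lt_castSucc_iff.1 hj)

lemma ext_of_phase_mem (F : HNFiltration S.P E) {I : Set ℝ} (h : ∀ i, F.phase i ∈ I) :
    S.ext I E := by
  refine ExtClosure.iso (Slicing.ext_mono ?_ (F.ext_obj (Fin.last _))) F.topIso
  rintro _ ⟨j, -, rfl⟩
  exact h j

/-- Were the projection zero, the identity of the factor would pass through the shift of the
previous step, whose phases are all larger. -/
lemma proj_ne_zero (F : HNFiltration S.P E) (i : Fin F.length) : F.proj i ≠ 0 := by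
  intro h
  refine F.nonzero i ((IsZero.iff_id_eq_zero _).2 ?_)
  obtain ⟨r, hr⟩ := Triangle.yoneda_exact₃ _ (F.distinguished i) (𝟙 (F.factor i)) (by
    change F.proj i ≫ 𝟙 _ = 0
    rw [h, zero_comp])
  have hr' : r = 0 := Slicing.ext_hom_eq_zero (S := S) (I := Set.Ioi (F.phase i))
    (J := {F.phase i}) (by rintro x hx _ rfl; exact hx)
    (Slicing.ext_shift 1 (fun x hx ↦ by
      have : F.phase i < x := hx
      change F.phase i < _
      push_cast; linarith) (F.ext_obj_castSucc i)) (.of ⟨_, rfl, F.mem i⟩) r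
  rw [hr, hr']
  exact comp_zero

/-- The obstruction to staying nonzero under `incl` is a morphism to a later factor shifted by `-1`,
which has smaller phase than the first factor. -/
lemma exists_from_first (F : HNFiltration S.P E) (i₀ : Fin F.length) (h₀ : (i₀ : ℕ) = 0)
    (i : Fin F.length) : ∃ g : F.factor i₀ ⟶ F.obj i.succ, g ≠ 0 := by
  obtain ⟨n, hn⟩ := i
  induction n with
  | zero =>
    obtain rfl : i₀ = ⟨0, hn⟩ := Fin.ext h₀
    have hz : IsZero (F.obj (Fin.castSucc ⟨0, hn⟩)) := F.isZero_bot
    have : IsIso (F.proj ⟨0, hn⟩) := (Triangle.isZero₁_iff_isIso₂ _ (F.distinguished ⟨0, hn⟩)).1 hz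
    refine ⟨inv (F.proj ⟨0, hn⟩), fun h ↦ F.nonzero ⟨0, hn⟩ ((IsZero.iff_id_eq_zero _).2 ?_)⟩
    rw [← IsIso.inv_hom_id (F.proj ⟨0, hn⟩), h, zero_comp]
  | succ n ih =>
    obtain ⟨g, hg⟩ := ih (by lia)
    refine ⟨g ≫ F.incl ⟨n + 1, hn⟩, fun h ↦ hg ?_⟩
    obtain ⟨r, hr⟩ := Triangle.coyoneda_exact₂ _ (inv_rot_of_distTriang _
      (F.distinguished ⟨n + 1, hn⟩)) g h
    have hlt : F.phase ⟨n + 1, hn⟩ < F.phase i₀ := F.strictAnti (by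
      rw [Fin.lt_def, h₀]; exact Nat.succ_pos n)
    have hr' : r = 0 := S.hom_eq_zero (F.phase i₀) (F.phase ⟨n + 1, hn⟩ + ((-1 : ℤ) : ℝ))
      (by push_cast; linarith) _ _ r (F.mem i₀) (Slicing.P_shift (F.mem _) (-1))
    rw [hr, hr']
    exact zero_comp

/-- It suffices to treat the last, smallest phase: if it were outside `I`, the nonzero projection of
`E` to the last factor would contradict Hom-vanishing. The lower-set version uses the first factor
instead. -/
lemma phase_mem_of_isUpperSet (F : HNFiltration S.P E) {I : Set ℝ} (hI : IsUpperSet I)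
    (hE : S.ext I E) (i : Fin F.length) : F.phase i ∈ I := by
  by_contra hi
  obtain ⟨n, hn⟩ : ∃ n, F.length = n + 1 := ⟨F.length - 1, by have := i.2; lia⟩
  let l : Fin F.length := ⟨n, by lia⟩
  have hl : F.phase l ∉ I := fun h ↦ hi (hI (F.strictAnti.antitone (Fin.le_def.2 (by
    have := i.2; change (i : ℕ) ≤ n; lia))) h)
  have hlast : l.succ = Fin.last _ := Fin.ext hn.symm
  let e : F.obj l.succ ≅ E := eqToIso (by rw [hlast]) ≪≫ F.topIso
  refine F.proj_ne_zero l ?_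
  have : e.inv ≫ F.proj l = 0 := Slicing.ext_hom_eq_zero (S := S) (I := I) (J := {F.phase l})
    (by
      rintro x hx _ rfl
      by_contra hx'
      exact hl (hI (not_lt.1 hx') hx)) hE (.of ⟨_, rfl, F.mem l⟩) _
  rw [← cancel_epi e.inv, this, comp_zero]

lemma phase_mem_of_isLowerSet (F : HNFiltration S.P E) {I : Set ℝ} (hI : IsLowerSet I)
    (hE : S.ext I E) (i : Fin F.length) : F.phase i ∈ I := by
  by_contra hi
  obtain ⟨n, hn⟩ : ∃ n, F.length = n + 1 := ⟨F.length - 1, by have := i.2; lia⟩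
  let z : Fin F.length := ⟨0, by lia⟩
  have hz : F.phase z ∉ I := fun h ↦ hi (hI (F.strictAnti.antitone (Fin.le_def.2 (Nat.zero_le _))) h)
  obtain ⟨g, hg⟩ := F.exists_from_first z rfl ⟨n, by lia⟩
  have hlast : Fin.succ ⟨n, by lia⟩ = Fin.last F.length := Fin.ext hn.symm
  let e : F.obj (Fin.succ ⟨n, by lia⟩) ≅ E := eqToIso (by rw [hlast]) ≪≫ F.topIso
  refine hg ?_
  have : g ≫ e.hom = 0 := Slicing.ext_hom_eq_zero (S := S) (I := {F.phase z}) (J := I)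
    (by
      rintro _ rfl x hx
      by_contra hx'
      exact hz (hI (not_lt.1 hx') hx)) (.of ⟨_, rfl, F.mem z⟩) hE _
  rw [← cancel_mono e.hom, this, zero_comp]

lemma length_eq_zero (F : HNFiltration S.P E) (hE : IsZero E) : F.length = 0 := by
  by_contra h
  exact F.phase_mem_of_isUpperSet (I := ∅) (fun _ _ _ h ↦ h) (.zero hE)
    ⟨0, Nat.pos_of_ne_zero h⟩

end HNFiltration

namespace Slicing

variable (S : Slicing C)

lemma phase_le_phiPlus (E : C) (i) : (S.hn E).phase i ≤ S.phiPlus E :=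
  le_ciSup (Set.finite_range _).bddAbove i

lemma phiMinus_le_phase (E : C) (i) : S.phiMinus E ≤ (S.hn E).phase i :=
  ciInf_le (Set.finite_range _).bddBelow i

lemma ext_Icc (E : C) : S.ext (Set.Icc (S.phiMinus E) (S.phiPlus E)) E :=
  (S.hn E).ext_of_phase_mem fun i ↦ ⟨S.phiMinus_le_phase E i, S.phase_le_phiPlus E i⟩

variable {S} in
lemma mem_of_ext (F : HNFiltration S.P E) {a b : ℝ} (h₁ : S.ext (Set.Ioi a) E)
    (h₂ : S.ext (Set.Iic b) E) (i : Fin F.length) : F.phase i ∈ Set.Ioc a b :=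
  ⟨F.phase_mem_of_isUpperSet (isUpperSet_Ioi a) h₁ i,
    F.phase_mem_of_isLowerSet (isLowerSet_Iic b) h₂ i⟩

/-- Phases decrease along the filtration: while they exceed `a` the whole step serves as `X`, and
every later factor is absorbed into `Y`. -/
lemma exists_isExtension [IsTriangulated C] (a : ℝ) (E : C) :
    ∃ X Y, S.ext (Set.Ioi a) X ∧ S.ext (Set.Iic a) Y ∧ IsExtension X E Y := by
  have H (i) : ∃ X Y, S.ext (Set.Ioi a) X ∧ S.ext (Set.Iic a) Y ∧
      IsExtension X ((S.hn E).obj i) Y := by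
    induction i using Fin.induction with
    | zero =>
      have hz := (S.hn E).isZero_bot
      exact ⟨_, _, .zero hz, .zero hz, .of_isZero_left hz (Iso.refl _)⟩
    | succ i hi =>
      have hT := IsExtension.of_distTriang ((S.hn E).distinguished i)
      rcases le_or_gt ((S.hn E).phase i) a with ha | ha
      · obtain ⟨X, Y, hX, hY, h⟩ := hi
        obtain ⟨D, h₁, h₂⟩ := h.assoc hT
        exact ⟨X, D, hX, .ext h₂ hY (.of ⟨_, ha, (S.hn E).mem i⟩), h₁⟩
      · refine ⟨_, 0, .ext hT (ext_mono (Set.Ioi_subset_Ioi ha.le) ((S.hn E).ext_obj_castSucc i))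
          (.of ⟨_, ha, (S.hn E).mem i⟩), .zero (isZero_zero C),
          .of_isZero_right (isZero_zero C) (Iso.refl _)⟩
  obtain ⟨X, Y, hX, hY, h⟩ := H (Fin.last _)
  exact ⟨X, Y, hX, hY, h.congr (Iso.refl _) (S.hn E).topIso (Iso.refl _)⟩

variable [IsTriangulated C]

/-- The t-structure with heart `P((a, a + 1])` attached to a slicing. -/
def tStructure (a : ℝ) : TStructure C where
  -- Shifting by `1` raises phases and lowers degrees, so degree `n` corresponds to the phases in
  -- `(a - n, a + 1 - n]`.
  le n := S.ext (Set.Ioi (a - n))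
  ge n := S.ext (Set.Iic (a + 1 - n))
  le_isClosedUnderIsomorphisms n := ⟨fun e h ↦ ExtClosure.iso h e⟩
  ge_isClosedUnderIsomorphisms n := ⟨fun e h ↦ ExtClosure.iso h e⟩
  le_shift n k n' h X hX := ext_shift k (fun x hx ↦ by
    subst h
    simp only [Set.mem_Ioi, Int.cast_add] at hx ⊢
    linarith) hX
  ge_shift n k n' h X hX := ext_shift k (fun x hx ↦ by
    subst h
    simp only [Set.mem_Iic, Int.cast_add] at hx ⊢
    linarith) hX
  zero' X Y f hX hY := ext_hom_eq_zero (fun x hx y hy ↦ by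
    simp only [Set.mem_Iic, Set.mem_Ioi, Int.cast_zero, Int.cast_one] at hx hy
    linarith) hX hY f
  le_zero_le X hX := ext_mono (Set.Ioi_subset_Ioi (by simp)) hX
  ge_one_le X hX := ext_mono (Set.Iic_subset_Iic.2 (by simp)) hX
  exists_triangle_zero_one E := by
    obtain ⟨X, Y, hX, hY, f, g, h, hT⟩ := S.exists_isExtension a E
    exact ⟨X, Y, by simpa using hX, by simpa using hY, f, g, h, hT⟩

lemma isBoundedTStructure (a : ℝ) : IsBoundedTStructure (S.tStructure a) := by
  intro E
  have h := S.ext_Icc E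
  refine ⟨⟨-⌈S.phiPlus E - (a + 1)⌉, ⟨ext_mono (fun x hx ↦ ?_) h⟩⟩,
    ⟨⌊a - S.phiMinus E⌋ + 1, ⟨ext_mono (fun x hx ↦ ?_) h⟩⟩⟩
  · have := Int.le_ceil (S.phiPlus E - (a + 1))
    simp only [Set.mem_Iic, Int.cast_neg]
    linarith [hx.2]
  · have := Int.lt_floor_add_one (a - S.phiMinus E)
    simp only [Set.mem_Ioi, Int.cast_add, Int.cast_one]
    linarith [hx.1]

lemma heart_tStructure (a : ℝ) :
    (S.tStructure a).heart = phaseInterval S.P (Set.Ioc a (a + 1)) := by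
  ext E
  constructor
  · rintro ⟨h₁, h₂⟩
    change S.ext (Set.Ioi (a - (0 : ℤ))) E at h₁
    change S.ext (Set.Iic (a + 1 - (0 : ℤ))) E at h₂
    exact ⟨S.hn E, mem_of_ext (S.hn E) (by simpa using h₁) (by simpa using h₂)⟩
  · rintro ⟨F, hF⟩
    exact ⟨F.ext_of_phase_mem fun i ↦ by simpa using (hF i).1,
      F.ext_of_phase_mem fun i ↦ by simpa using (hF i).2⟩

end Slicing

end Slicings

/-! ### Mass inequalities for a single stability condition. -/

section MassEstimates

variable {C : Type u} [Category.{v} C] [Preadditive C] [HasZeroObject C] [HasShift C ℤ]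
  [∀ n : ℤ, (shiftFunctor C n).Additive] [Pretriangulated C]
  {Λ : Type w} [AddCommGroup Λ] {p : GrothendieckGroup C →+ Λ}

/-- Additivity is required only along the filtration, so this also applies to `cohValue`, which is
not additive on all triangles. -/
lemma HNFiltration.eq_sum_factor {P : ℝ → ObjectProperty C} {E : C} (F : HNFiltration P E)
    (f : C → ℝ) (zero : ∀ X, IsZero X → f X = 0) (iso : ∀ X Y, (X ≅ Y) → f X = f Y)
    (step : ∀ i, f (F.obj i.succ) = f (F.obj i.castSucc) + f (F.factor i)) :
    f E = ∑ i, f (F.factor i) := by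
  have H (i : Fin (F.length + 1)) :
      f (F.obj i) = ∑ j : Fin F.length, if j.castSucc < i then f (F.factor j) else 0 := by
    induction i using Fin.induction with
    | zero => simp [zero _ F.isZero_bot]
    | succ i hi =>
      rw [step, hi, ← Fintype.sum_ite_eq i (fun j ↦ f (F.factor j)), ← Finset.sum_add_distrib]
      refine Finset.sum_congr rfl fun j _ ↦ ?_
      rcases lt_trichotomy j i with h | h | h
      · rw [if_pos (Fin.castSucc_lt_castSucc_iff.2 h), if_neg h.ne', add_zero,
          if_pos ((Fin.castSucc_lt_castSucc_iff.2 h).trans Fin.castSucc_lt_succ)]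
      · subst h
        simp
      · rw [if_neg (by simpa using h.le), if_neg h.ne, add_zero, if_neg]
        rw [Fin.castSucc_lt_succ_iff]
        exact not_le.2 h
  rw [← iso _ _ F.topIso, H]
  exact Finset.sum_congr rfl fun j _ ↦ if_pos (Fin.castSucc_lt_last j)

lemma classOf_eq_add {X Y Z : C} (h : IsExtension X Y Z) :
    classOf Y = classOf X + classOf Z := by
  obtain ⟨f, g, h, hT⟩ := h
  rw [classOf, classOf, classOf, ← QuotientAddGroup.mk_add, eq_comm, QuotientAddGroup.eq]
  refine AddSubgroup.subset_closure ⟨_, hT, ?_⟩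
  change _ = FreeAbelianGroup.of Y - FreeAbelianGroup.of X - FreeAbelianGroup.of Z
  abel

namespace StabilityCondition

variable (σ : StabilityCondition p)

/-- The imaginary part of the central charge rotated by the phase `a`. -/
noncomputable def rotatedIm (a : ℝ) (E : C) : ℝ :=
  (Complex.exp (-(a * Real.pi : ℝ) * Complex.I) * σ.Z (p (classOf E))).im

/-- The sum of the absolute values of `rotatedIm` on the Harder-Narasimhan factors. -/
noncomputable def imMass (a : ℝ) (E : C) : ℝ := ∑ i, |σ.rotatedIm a ((σ.slicing.hn E).factor i)|

lemma isAdditiveFunction_rotatedIm (a : ℝ) : IsAdditiveFunction (σ.rotatedIm a) := by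
  intro X Y Z h
  simp only [rotatedIm, classOf_eq_add h, map_add, mul_add, Complex.add_im]

lemma rotatedIm_of_P {φ : ℝ} {E : C} (h : σ.slicing.P φ E) (a : ℝ) :
    σ.rotatedIm a E = ‖σ.Z (p (classOf E))‖ * Real.sin (Real.pi * (φ - a)) := by
  by_cases hE : IsZero E
  · have : classOf E = 0 := by
      have := classOf_eq_add (IsExtension.of_isZero_left hE (Iso.refl E))
      exact left_eq_add.1 this
    simp [rotatedIm, this]
  · obtain ⟨r, hr, hZ⟩ := σ.compatible φ E h hE
    have h₁ : Complex.exp (-(a * Real.pi : ℝ) * Complex.I) * σ.Z (p (classOf E)) =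
        r * Complex.exp ((Real.pi * (φ - a) : ℝ) * Complex.I) := by
      rw [hZ, mul_left_comm, ← Complex.exp_add]
      congr 2
      push_cast
      ring
    have h₂ : ‖σ.Z (p (classOf E))‖ = r := by
      rw [hZ, mul_comm Complex.I, mul_right_comm, ← Complex.ofReal_mul]
      rw [norm_mul, Complex.norm_exp_ofReal_mul_I, mul_one, Complex.norm_real,
        Real.norm_of_nonneg hr.le]
    rw [rotatedIm, h₁, h₂, Complex.im_ofReal_mul, Complex.exp_ofReal_mul_I_im]

lemma abs_rotatedIm_le (a : ℝ) (E : C) : |σ.rotatedIm a E| ≤ ‖σ.Z (p (classOf E))‖ := by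
  refine (Complex.abs_im_le_norm _).trans ?_
  rw [norm_mul, ← Complex.ofReal_neg, Complex.norm_exp_ofReal_mul_I, one_mul]

lemma imMass_le_mass (a : ℝ) (E : C) : σ.imMass a E ≤ σ.mass E :=
  Finset.sum_le_sum fun _ _ ↦ σ.abs_rotatedIm_le a _

lemma mass_nonneg (E : C) : 0 ≤ σ.mass E := Finset.sum_nonneg fun _ _ ↦ norm_nonneg _

/-- From `sin (y - x) = sin y cos x - cos y sin x`: the components of a vector in two independent
directions control its length. -/
lemma abs_sin_mul_mass_le (a b : ℝ) (E : C) :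
    |Real.sin (Real.pi * (a - b))| * σ.mass E ≤ σ.imMass a E + σ.imMass b E := by
  rw [mass, imMass, imMass, Finset.mul_sum, ← Finset.sum_add_distrib]
  refine Finset.sum_le_sum fun i _ ↦ ?_
  rw [σ.rotatedIm_of_P ((σ.slicing.hn E).mem i), σ.rotatedIm_of_P ((σ.slicing.hn E).mem i),
    abs_mul, abs_mul, abs_norm, ← mul_add, mul_comm]
  refine mul_le_mul_of_nonneg_left ?_ (norm_nonneg _)
  set x := Real.pi * ((σ.slicing.hn E).phase i - a)
  set y := Real.pi * ((σ.slicing.hn E).phase i - b)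
  have : Real.pi * (a - b) = y - x := by ring
  rw [this, Real.sin_sub]
  refine (abs_sub _ _).trans ?_
  rw [abs_mul, abs_mul, add_comm |Real.sin x|]
  exact add_le_add (mul_le_of_le_one_right (abs_nonneg _) (Real.abs_cos_le_one _))
    (mul_le_of_le_one_left (abs_nonneg _) (Real.abs_cos_le_one _))

/-- When all phases lie in a sector inside the rotated upper half plane, the contributions of the
factors cannot cancel. -/
lemma mul_mass_le_rotatedIm {a c : ℝ} {E : C}
    (h : ∀ i, c ≤ Real.sin (Real.pi * ((σ.slicing.hn E).phase i - a))) :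
    c * σ.mass E ≤ σ.rotatedIm a E := by
  have hW := σ.isAdditiveFunction_rotatedIm a
  rw [(σ.slicing.hn E).eq_sum_factor (σ.rotatedIm a) (fun _ ↦ hW.isZero) (fun _ _ ↦ hW.iso)
    (fun i ↦ hW _ _ _ (.of_distTriang ((σ.slicing.hn E).distinguished i))), mass, Finset.mul_sum]
  refine Finset.sum_le_sum fun i _ ↦ ?_
  rw [σ.rotatedIm_of_P ((σ.slicing.hn E).mem i), mul_comm]
  exact mul_le_mul_of_nonneg_left (h i) (norm_nonneg _)

lemma rotatedIm_le_mass (a : ℝ) (E : C) : σ.rotatedIm a E ≤ σ.mass E := by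
  have hW := σ.isAdditiveFunction_rotatedIm a
  rw [(σ.slicing.hn E).eq_sum_factor (σ.rotatedIm a) (fun _ ↦ hW.isZero) (fun _ _ ↦ hW.iso)
    (fun i ↦ hW _ _ _ (.of_distTriang ((σ.slicing.hn E).distinguished i))), mass]
  exact Finset.sum_le_sum fun i _ ↦ (le_abs_self _).trans (σ.abs_rotatedIm_le a _)

lemma mass_isZero {E : C} (hE : IsZero E) : σ.mass E = 0 := by
  have := (σ.slicing.hn E).length_eq_zero hE
  have : IsEmpty (Fin (σ.slicing.hn E).length) := by rw [this]; infer_instance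
  exact Finset.sum_of_isEmpty _

lemma mass_le_imMass (E : C) : σ.mass E ≤ σ.imMass 0 E + σ.imMass (1 / 2) E := by
  have := σ.abs_sin_mul_mass_le (1 / 2) 0 E
  rw [sub_zero, mul_one_div, Real.sin_pi_div_two, abs_one, one_mul] at this
  linarith

variable [IsTriangulated C]

lemma rotatedIm_nonneg (a : ℝ) (E : C) (hE : (σ.slicing.tStructure a).heart E) :
    0 ≤ σ.rotatedIm a E := by
  rw [Slicing.heart_tStructure] at hE
  obtain ⟨F, hF⟩ := hE
  have hW := σ.isAdditiveFunction_rotatedIm a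
  rw [F.eq_sum_factor (σ.rotatedIm a) (fun _ ↦ hW.isZero) (fun _ _ ↦ hW.iso)
    (fun i ↦ hW _ _ _ (.of_distTriang (F.distinguished i)))]
  refine Finset.sum_nonneg fun i _ ↦ ?_
  rw [σ.rotatedIm_of_P (F.mem i)]
  refine mul_nonneg (norm_nonneg _) (Real.sin_nonneg_of_nonneg_of_le_pi ?_ ?_)
  · exact mul_nonneg Real.pi_pos.le (by linarith [(hF i).1])
  · exact mul_le_of_le_one_right Real.pi_pos.le (by linarith [(hF i).2])

/-- Each Harder–Narasimhan factor sits in a single degree, where its signed value is `|W|`. This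
identifies `imMass` with a quantity whose behaviour on triangles is known. -/
lemma hasSum_cohValue (a : ℝ) (E : C) :
    HasSum (fun n ↦ cohValue (σ.slicing.tStructure a) (σ.rotatedIm a) n E) (σ.imMass a E) := by
  have hW := σ.isAdditiveFunction_rotatedIm a
  let F := σ.slicing.hn E
  let t := σ.slicing.tStructure a
  -- Larger phases mean smaller degrees, so the step preceding a factor of degree `k` lies in
  -- degrees `≤ k`, as `cohValue_add` requires.
  have H (i) : ∃ k : ℤ, t.IsLE (F.factor i) k ∧ t.IsGE (F.factor i) k ∧
      t.IsLE (F.obj i.castSucc) k := by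
    have h₁ := Int.le_ceil (F.phase i - (a + 1))
    have h₂ := Int.ceil_lt_add_one (F.phase i - (a + 1))
    refine ⟨-⌈F.phase i - (a + 1)⌉, ⟨.of ⟨_, ?_, F.mem i⟩⟩, ⟨.of ⟨_, ?_, F.mem i⟩⟩,
      ⟨Slicing.ext_mono (Set.Ioi_subset_Ioi ?_) (F.ext_obj_castSucc i)⟩⟩
    · simp only [Set.mem_Ioi, Int.cast_neg]; linarith
    · simp only [Set.mem_Iic, Int.cast_neg]; linarith
    · simp only [Int.cast_neg]; linarith
  have key (n : ℤ) : cohValue t (σ.rotatedIm a) n E =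
      ∑ i, cohValue t (σ.rotatedIm a) n (F.factor i) :=
    F.eq_sum_factor _ (fun _ h ↦ cohValue_isZero hW h n) (fun _ _ e ↦ cohValue_iso hW e n)
      (fun i ↦ by
        obtain ⟨k, -, h₂, h₃⟩ := H i
        exact cohValue_add hW (.of_distTriang (F.distinguished i)) k h₃ h₂ n)
  simp only [t] at key
  simp only [key]
  refine hasSum_sum fun i _ ↦ ?_
  obtain ⟨k, h₁, h₂, -⟩ := H i
  have : |σ.rotatedIm a (F.factor i)| = (k.negOnePow : ℤ) * σ.rotatedIm a (F.factor i) := by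
    rw [← abs_of_nonneg (negOnePow_mul_nonneg hW (σ.rotatedIm_nonneg a) k h₁ h₂), abs_mul,
      ← Int.cast_abs, Int.abs_negOnePow, Int.cast_one, one_mul]
  rw [this]
  have e (n : ℤ) := cohValue_of_heart hW k h₁ h₂ n
  simp only [t] at e
  simp only [e]
  exact hasSum_ite_eq k _

lemma imMass_le (a : ℝ) {E F G : C} (h : IsExtension E F G) :
    σ.imMass a F ≤ σ.imMass a E + σ.imMass a G :=
  hasSum_le (fun n ↦ cohValue_le (σ.isAdditiveFunction_rotatedIm a) (σ.rotatedIm_nonneg a)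
    (σ.slicing.isBoundedTStructure a) h n) (σ.hasSum_cohValue a F)
    ((σ.hasSum_cohValue a E).add (σ.hasSum_cohValue a G))

lemma imMass_shift (a : ℝ) (E : C) (n : ℤ) : σ.imMass a (E⟦n⟧) = σ.imMass a E := by
  have h := σ.hasSum_cohValue a (E⟦n⟧)
  simp only [cohValue_shift (σ.isAdditiveFunction_rotatedIm a)] at h
  exact h.unique ((Equiv.hasSum_iff (Equiv.addRight n)).2 (σ.hasSum_cohValue a E))

/-- Here `E` is the truncation of `F` to degrees `≤ 0`, so its cohomology is part of that of `F`. -/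
lemma imMass_left_le (a : ℝ) {E F G : C} (h : IsExtension E F G)
    (hE : σ.slicing.ext (Set.Ioi a) E) (hG : σ.slicing.ext (Set.Iic a) G) :
    σ.imMass a E ≤ σ.imMass a F := by
  refine hasSum_le (fun n ↦ ?_) (σ.hasSum_cohValue a E) (σ.hasSum_cohValue a F)
  rw [cohValue_add (σ.isAdditiveFunction_rotatedIm a) h 0
    ⟨Slicing.ext_mono (Set.Ioi_subset_Ioi (by simp)) hE⟩
    ⟨Slicing.ext_mono (Set.Iic_subset_Iic.2 (by simp)) hG⟩]
  exact le_add_of_nonneg_right (cohValue_nonneg (σ.isAdditiveFunction_rotatedIm a)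
    (σ.rotatedIm_nonneg a) _ _)

lemma mass_le {E F G : C} (h : IsExtension E F G) : σ.mass F ≤ 2 * (σ.mass E + σ.mass G) := by
  have := σ.mass_le_imMass F
  linarith [σ.imMass_le 0 h, σ.imMass_le (1 / 2) h, σ.imMass_le_mass 0 E, σ.imMass_le_mass 0 G,
    σ.imMass_le_mass (1 / 2) E, σ.imMass_le_mass (1 / 2) G]

lemma mass_shift_le (E : C) (n : ℤ) : σ.mass (E⟦n⟧) ≤ 2 * σ.mass E := by
  have := σ.mass_le_imMass (E⟦n⟧)
  rw [imMass_shift, imMass_shift] at this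
  linarith [σ.imMass_le_mass 0 E, σ.imMass_le_mass (1 / 2) E]

/-- A phase gap between `a` and `b` makes `E` a truncation of `F` for both t-structures, and two
distinct angles are needed to recover the mass. -/
lemma mass_left_le {a b : ℝ} (hab : a ≤ b) {E F G : C} (h : IsExtension E F G)
    (hE : σ.slicing.ext (Set.Ioi b) E) (hG : σ.slicing.ext (Set.Iic a) G) :
    |Real.sin (Real.pi * (b - a))| * σ.mass E ≤ 2 * σ.mass F := by
  have := σ.abs_sin_mul_mass_le b a E
  linarith [σ.imMass_left_le b h hE (Slicing.ext_mono (Set.Iic_subset_Iic.2 hab) hG),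
    σ.imMass_left_le a h (Slicing.ext_mono (Set.Ioi_subset_Ioi hab) hE) hG,
    σ.imMass_le_mass a F, σ.imMass_le_mass b F]

end StabilityCondition

end MassEstimates

/-! ### Limits of phases and massless objects. -/

section Massless

variable {C : Type u} [Category.{v} C] [Preadditive C] [HasZeroObject C] [HasShift C ℤ]
  [∀ n : ℤ, (shiftFunctor C n).Additive] [Pretriangulated C]
  {Λ : Type w} [AddCommGroup Λ] {p : GrothendieckGroup C →+ Λ} {σ : ℕ → StabilityCondition p}

lemma massless_of_eventually_le {E : C} {c : ℝ} (hc : 0 < c) {f : ℕ → ℝ}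
    (hf : Tendsto f atTop (𝓝 0)) (h : ∀ᶠ n in atTop, c * (σ n).mass E ≤ f n) :
    massless σ E := by
  refine squeeze_zero' (Eventually.of_forall fun n ↦ (σ n).mass_nonneg E)
    (h.mono fun n hn ↦ (le_div_iff₀' hc).2 hn) ?_
  simpa using hf.div_const c

lemma massless_isZero {E : C} (hE : IsZero E) : massless σ E := by
  simp only [massless, StabilityCondition.mass_isZero _ hE]
  exact tendsto_const_nhds

lemma limitPhase_ext {φ : ℝ} {E : C} (h : limitPhase σ φ E) {ε : ℝ} (hε : 0 < ε) :
    ∀ᶠ n in atTop, (σ n).slicing.ext (Set.Ioo (φ - ε) (φ + ε)) E := by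
  rcases h with h | ⟨h₁, h₂⟩
  · exact Eventually.of_forall fun n ↦ .zero h
  · filter_upwards [h₁.eventually_lt_const (lt_add_of_pos_right φ hε),
      h₂.eventually_const_lt (sub_lt_self φ hε)] with n h₁ h₂
    exact Slicing.ext_mono (Set.Icc_subset_Ioo h₂ h₁) ((σ n).slicing.ext_Icc E)

/-- The finitely many limit phases are positive, hence uniformly bounded away from `0`; phase `1`
may occur, so above only `1 + ε` is available. -/
lemma limitHeart_ext {E : C} (h : limitHeart σ E) :
    ∃ δ > 0, ∀ ε > 0, ∀ᶠ n in atTop, (σ n).slicing.ext (Set.Ioo δ (1 + ε)) E := by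
  obtain ⟨F, hF⟩ := h
  -- The factor `2` leaves a margin `δ` for the convergence of the phases.
  obtain ⟨δ, hδ, hδ'⟩ : ∃ δ > 0, ∀ i, 2 * δ < F.phase i := by
    have h₁ : ∀ᶠ δ : ℝ in 𝓝[>] 0, ∀ i, 2 * δ < F.phase i := eventually_all.2 fun i ↦ by
      filter_upwards [Ioo_mem_nhdsGT (half_pos (hF i).1)] with δ hδ
      linarith [hδ.2]
    obtain ⟨δ, h, h'⟩ := (h₁.and self_mem_nhdsWithin).exists
    exact ⟨δ, h', h⟩
  refine ⟨δ, hδ, fun ε hε ↦ ?_⟩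
  have H : ∀ᶠ n in atTop, ∀ i, (σ n).slicing.ext (Set.Ioo δ (1 + ε)) (F.factor i) := by
    refine eventually_all.2 fun i ↦ (limitPhase_ext (F.mem i) (lt_min hδ hε)).mono fun n hn ↦ ?_
    refine Slicing.ext_mono (fun x hx ↦ Set.mem_Ioo.2 ⟨?_, ?_⟩) hn
    · linarith [hx.1, min_le_left δ ε, hδ' i]
    · linarith [hx.2, min_le_right δ ε, (hF i).2]
  filter_upwards [H] with n hn
  exact F.induction (Φ := fun _ X ↦ (σ n).slicing.ext _ X) (fun _ h ↦ .zero h)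
    (fun i _ _ h hX ↦ .ext h hX (hn i)) (fun _ _ _ e h ↦ ExtClosure.iso h e)

section Truncation

variable {t : TStructure C} (ht : IsBoundedTStructure t) (hA : t.heart = limitHeart σ)

include hA in
lemma ext_of_heart_shift {Z : C} {k : ℤ} (h₁ : t.IsLE Z k) (h₂ : t.IsGE Z k) :
    ∃ δ > 0, ∀ ε > 0, ∀ᶠ n in atTop, (σ n).slicing.ext (Set.Ioo (δ - k) (1 + ε - k)) Z := by
  have h : limitHeart σ (Z⟦k⟧) := by
    rw [← hA, t.mem_heart_iff]
    exact ⟨t.isLE_shift Z k k 0, t.isGE_shift Z k k 0⟩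
  obtain ⟨δ, hδ, H⟩ := limitHeart_ext h
  refine ⟨δ, hδ, fun ε hε ↦ (H ε hε).mono fun n hn ↦
    ExtClosure.iso (Slicing.ext_shift (-k) (fun x hx ↦ ?_) hn) (shiftShiftNeg Z k)⟩
  constructor <;> push_cast
  · linarith [hx.1]
  · linarith [hx.2]

variable [IsTriangulated C]

include ht hA

/-- The finitely many cohomology objects sit in degrees `k ≤ 0`, where phases eventually exceed `δ -
k ≥ δ`. Dually, in degrees `k ≥ 1` they are eventually below `1 + ε - k ≤ ε`. -/
lemma ext_Ioi_of_isLE (X : C) [t.IsLE X 0] :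
    ∃ δ > 0, ∀ᶠ n in atTop, (σ n).slicing.ext (Set.Ioi δ) X := by
  obtain ⟨a, ha⟩ := (ht X).1
  refine tStructure_induction t
    (Φ := fun X ↦ ∃ δ > 0, ∀ᶠ n in atTop, (σ n).slicing.ext (Set.Ioi δ) X) a 0
    (fun X hX ↦ ⟨1, one_pos, Eventually.of_forall fun n ↦ .zero hX⟩) ?_ X
  rintro X Y Z k - hk h - h₁ h₂ ⟨δ, hδ, H⟩
  obtain ⟨δ', hδ', H'⟩ := ext_of_heart_shift hA h₁ h₂
  refine ⟨min δ δ', lt_min hδ hδ', ?_⟩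
  have hk' : (k : ℝ) ≤ 0 := by exact_mod_cast hk
  filter_upwards [H, H' 1 one_pos] with n h₃ h₄
  refine .ext h (Slicing.ext_mono (Set.Ioi_subset_Ioi (min_le_left _ _)) h₃)
    (Slicing.ext_mono (fun x hx ↦ ?_) h₄)
  have := hx.1
  have := min_le_right δ δ'
  simp only [Set.mem_Ioi]
  linarith

lemma ext_Iic_of_isGE (X : C) [t.IsGE X 1] {ε : ℝ} (hε : 0 < ε) :
    ∀ᶠ n in atTop, (σ n).slicing.ext (Set.Iic ε) X := by
  obtain ⟨b, hb⟩ := (ht X).2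
  refine tStructure_induction t
    (Φ := fun X ↦ ∀ᶠ n in atTop, (σ n).slicing.ext (Set.Iic ε) X) 1 b
    (fun X hX ↦ Eventually.of_forall fun n ↦ .zero hX) ?_ X
  rintro X Y Z k hk - h - h₁ h₂ H
  obtain ⟨δ', hδ', H'⟩ := ext_of_heart_shift hA h₁ h₂
  have hk' : (1 : ℝ) ≤ k := by exact_mod_cast hk
  filter_upwards [H, H' ε hε] with n h₃ h₄
  exact .ext h h₃ (Slicing.ext_mono (fun x hx ↦ by
    have := hx.2
    simp only [Set.mem_Iic]
    linarith) h₄)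

lemma massless_of_truncation {X Y Z : C} (h : IsExtension X Y Z) (hX : t.IsLE X 0)
    (hZ : t.IsGE Z 1) (hY : massless σ Y) : massless σ X := by
  obtain ⟨δ, hδ, H⟩ := ext_Ioi_of_isLE ht hA X
  -- Eventually `X` has phases above `η` and `Z` at most `η / 2`; this gap does not depend on `n`,
  -- and `η ≤ 1` keeps its sine positive.
  obtain ⟨η, hη, hη₁, hη₂⟩ : ∃ η > 0, η ≤ δ ∧ η ≤ 1 :=
    ⟨min δ 1, lt_min hδ one_pos, min_le_left _ _, min_le_right _ _⟩
  have hs : 0 < |Real.sin (Real.pi * (η - η / 2))| := abs_pos.2 (ne_of_gt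
    (Real.sin_pos_of_pos_of_lt_pi (mul_pos Real.pi_pos (by linarith))
      (mul_lt_of_lt_one_right Real.pi_pos (by linarith))))
  refine massless_of_eventually_le hs (f := fun n ↦ 2 * (σ n).mass Y) ?_ ?_
  · simpa using Tendsto.const_mul 2 hY
  · filter_upwards [H, ext_Iic_of_isGE ht hA Z (half_pos hη)] with n h₁ h₂
    exact (σ n).mass_left_le (half_le_self hη.le) h
      (Slicing.ext_mono (Set.Ioi_subset_Ioi hη₁) h₁) h₂

end Truncation

lemma massless_of_heart {E F G : C} (h : IsExtension E F G) (hE : limitHeart σ E)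
    (hG : limitHeart σ G) (hF : massless σ F) : massless σ E ∧ massless σ G := by
  obtain ⟨δ₁, hδ₁, H₁⟩ := limitHeart_ext hE
  obtain ⟨δ₂, hδ₂, H₂⟩ := limitHeart_ext hG
  obtain ⟨δ, hδ, h₁, h₂, h₃⟩ : ∃ δ > 0, δ ≤ δ₁ ∧ δ ≤ δ₂ ∧ δ ≤ 1 :=
    ⟨min (min δ₁ δ₂) 1, lt_min (lt_min hδ₁ hδ₂) one_pos, (min_le_left _ _).trans (min_le_left _ _),
      (min_le_left _ _).trans (min_le_right _ _), min_le_right _ _⟩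
  have hc : 0 < Real.sin (Real.pi * (δ / 4)) :=
    Real.sin_pos_of_pos_of_lt_pi (mul_pos Real.pi_pos (by linarith))
      (mul_lt_of_lt_one_right Real.pi_pos (by linarith))
  -- Rotation by `3δ/4` carries `(δ, 1 + δ/2)` to `(δ/4, 1 - δ/4)`, where the sine of `π` times the
  -- phase is at least `sin (πδ/4)`.
  have key (n : ℕ) (X : C) (hX : (σ n).slicing.ext (Set.Ioo δ (1 + δ / 2)) X) :
      Real.sin (Real.pi * (δ / 4)) * (σ n).mass X ≤ (σ n).rotatedIm (3 * δ / 4) X := by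
    refine (σ n).mul_mass_le_rotatedIm fun i ↦ ?_
    have hi₁ : δ < _ := ((σ n).slicing.hn X).phase_mem_of_isUpperSet (isUpperSet_Ioi δ)
      (Slicing.ext_mono Set.Ioo_subset_Ioi_self hX) i
    have hi₂ : _ < 1 + δ / 2 := ((σ n).slicing.hn X).phase_mem_of_isLowerSet
      (isLowerSet_Iio (1 + δ / 2)) (Slicing.ext_mono Set.Ioo_subset_Iio_self hX) i
    set x := ((σ n).slicing.hn X).phase i
    have hπ := Real.pi_pos
    rcases le_or_gt (x - 3 * δ / 4) (1 / 2) with hx | hx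
    · exact Real.sin_le_sin_of_le_of_le_pi_div_two (by nlinarith) (by nlinarith) (by nlinarith)
    · rw [← Real.sin_pi_sub (Real.pi * (x - 3 * δ / 4))]
      exact Real.sin_le_sin_of_le_of_le_pi_div_two (by nlinarith) (by nlinarith) (by nlinarith)
  have H : ∀ᶠ n in atTop, Real.sin (Real.pi * (δ / 4)) * ((σ n).mass E + (σ n).mass G) ≤
      (σ n).mass F := by
    filter_upwards [H₁ _ (half_pos hδ), H₂ _ (half_pos hδ)] with n hn₁ hn₂
    have := key n E (Slicing.ext_mono (Set.Ioo_subset_Ioo_left h₁) hn₁)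
    have := key n G (Slicing.ext_mono (Set.Ioo_subset_Ioo_left h₂) hn₂)
    have := (σ n).isAdditiveFunction_rotatedIm (3 * δ / 4) _ _ _ h
    have := (σ n).rotatedIm_le_mass (3 * δ / 4) F
    linarith
  exact ⟨massless_of_eventually_le hc hF (H.mono fun n hn ↦ by
      nlinarith [(σ n).mass_nonneg G]),
    massless_of_eventually_le hc hF (H.mono fun n hn ↦ by nlinarith [(σ n).mass_nonneg E])⟩

variable [IsTriangulated C]

lemma massless_of_isExtension {E F G : C} (h : IsExtension E F G) (hE : massless σ E)
    (hG : massless σ G) : massless σ F := by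
  refine massless_of_eventually_le one_pos (f := fun n ↦ 2 * ((σ n).mass E + (σ n).mass G)) ?_
    (Eventually.of_forall fun n ↦ by simpa using (σ n).mass_le h)
  simpa using (Tendsto.add hE hG).const_mul 2

instance : (massless σ).IsClosedUnderIsomorphisms where
  of_iso e h := massless_of_isExtension (.of_isZero_right (isZero_zero C) e) h
    (massless_isZero (isZero_zero C))

instance isTriangulated_massless : (massless σ).IsTriangulated where
  exists_zero := ⟨0, isZero_zero C, massless_isZero (isZero_zero C)⟩
  isStableUnderShiftBy n := ⟨fun X hX ↦ massless_of_eventually_le one_pos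
    (f := fun k ↦ 2 * (σ k).mass X) (by simpa using Tendsto.const_mul 2 hX)
    (Eventually.of_forall fun k ↦ by simpa using (σ k).mass_shift_le X n)⟩
  toIsTriangulatedClosed₂ := .mk' fun T hT h₁ h₃ ↦
    massless_of_isExtension (.of_distTriang hT) h₁ h₃

end Massless

/-! ### Descent of a t-structure to a Verdier quotient. -/

section QuotientTStructure

variable {C : Type u} [Category.{v} C] [Preadditive C] [HasZeroObject C] [HasShift C ℤ]
  [∀ n : ℤ, (shiftFunctor C n).Additive] [Pretriangulated C]
  (t : TStructure C) (K : ObjectProperty C) [K.IsTriangulated]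

/-- `K` is closed under truncations for `t`, and quotients in the heart of objects of `K` are
in `K`. -/
structure IsCompatible : Prop where
  truncation : ∀ {X Y Z : C}, IsExtension X Y Z → t.IsLE X 0 → t.IsGE Z 1 → K Y → K X
  quotient : ∀ {X Y Z : C}, IsExtension X Y Z → t.heart X → t.heart Z → K Y → K Z

variable {t K}

lemma quotient_isExtension [IsTriangulated C] {X Y Z : C} (h : IsExtension X Y Z) :
    IsExtension (K.trW.Q.obj X) (K.trW.Q.obj Y) (K.trW.Q.obj Z) := by
  obtain ⟨_, _, _, hT⟩ := h
  exact .of_distTriang (K.trW.Q.map_distinguished _ hT)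

variable [K.IsClosedUnderIsomorphisms]

lemma prop_of_shift {X : C} (n : ℤ) (h : K (X⟦n⟧)) : K X :=
  K.prop_of_iso (shiftShiftNeg X n) (K.le_shift (-n) _ h)

lemma IsExtension.prop_mid {X Y Z : C} (h : IsExtension X Y Z) (hX : K X) (hZ : K Z) : K Y := by
  obtain ⟨_, _, _, hT⟩ := h
  exact K.ext_of_isTriangulatedClosed₂ _ hT hX hZ

lemma IsExtension.prop_right {X Y Z : C} (h : IsExtension X Y Z) (hX : K X) (hY : K Y) : K Z := by
  obtain ⟨_, _, _, hT⟩ := h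
  exact K.ext_of_isTriangulatedClosed₃ _ hT hX hY

namespace IsCompatible

variable (hK : IsCompatible t K)

include hK

lemma truncation_left {X Y Z : C} (h : IsExtension X Y Z) (n : ℤ) (hX : t.IsLE X n)
    (hZ : t.IsGE Z (n + 1)) (hY : K Y) : K X :=
  prop_of_shift n (hK.truncation (h.shift n) (t.isLE_shift X n n 0)
    (t.isGE_shift Z (n + 1) n 1) (K.le_shift n _ hY))

lemma truncation_right {X Y Z : C} (h : IsExtension X Y Z) (n : ℤ) (hX : t.IsLE X n)
    (hZ : t.IsGE Z (n + 1)) (hY : K Y) : K Z :=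
  h.prop_right (hK.truncation_left h n hX hZ hY) hY

variable [IsTriangulated C]

/-- Lets the roof `X ⟵ X'` be refined by some `X''` in degrees `≤ 0`. The part of `U` in degrees `≤
0` is kept in `X''`; its part in degrees `≥ 2` splits off from `X` and goes into `R`; of its degree
`1` cohomology, the cokernel of the connecting map from `X` goes into `R`. -/
lemma exists_isLE {U X' X : C} (h : IsExtension U X' X) (hU : K U) (hX : t.IsLE X 0) :
    ∃ X'' R, t.IsLE X'' 0 ∧ K R ∧ IsExtension X'' X' R := by
  have hU₀₁ := isExtension_trunc t U 1
  have hU₁ := hK.truncation_right hU₀₁ 0 (t.isLE_truncLT_obj _ _ _) (t.isGE_truncGE_obj _ _ _) hU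
  have hU₂₃ := isExtension_trunc t ((t.truncGE 1).obj U) 2
  have hU₂ := hK.truncation_left hU₂₃ 1 (t.isLE_truncLT_obj _ _ _) (t.isGE_truncGE_obj _ _ _) hU₁
  have hU₃ := hK.truncation_right hU₂₃ 1 (t.isLE_truncLT_obj _ _ _) (t.isGE_truncGE_obj _ _ _) hU₁
  obtain ⟨Y, hY, hY'⟩ := hU₀₁.assoc h
  obtain ⟨Y₁, hY₁, hY₁'⟩ := hU₂₃.assoc hY'
  obtain ⟨Y₂, hY₂, hY₂'⟩ := hY₁.assoc' (hY₁'.swap fun f ↦ t.zero_of_isLE_of_isGE f 0 1 (by lia) hX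
    (t.isGE_shift _ 2 1 1))
  have hLV := isExtension_trunc t Y₂ 1
  have hY₂LE : t.IsLE Y₂ 1 := hY₂'.isLE_mid (t.isLE_truncLT_obj _ _ _) (t.isLE_of_le X 0 1)
  -- `I` is the image of the connecting map from `X⟦-1⟧` to `U₂`, in degree `1`. Hence `τ^{≥1} Y₂`
  -- is, after a shift, a quotient in the heart of an object of `K`.
  obtain ⟨I, hI, hI'⟩ := hY₂'.invRotate.assoc' hLV
  have hI₁ : t.IsLE I 1 := hI'.isLE_mid (t.isLE_shift X 0 (-1) 1) (t.isLE_of_le _ (1 - 1) 1)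
  have hI₂ : t.IsGE I 1 := hI.isGE_left inferInstance (t.isGE_of_ge _ (1 - 1) 1)
  have hV : K ((t.truncGE 1).obj Y₂) := prop_of_shift 1 (hK.quotient (hI.shift 1)
    ((t.mem_heart_iff _).2 ⟨t.isLE_shift I 1 1 0, t.isGE_shift I 1 1 0⟩)
    ((t.mem_heart_iff _).2 ⟨t.isLE_shift _ 1 1 0, t.isGE_shift _ 1 1 0⟩) (K.le_shift 1 _ hU₂))
  obtain ⟨R, hR, hR'⟩ := hLV.assoc hY₂
  obtain ⟨X'', hX'', hX'''⟩ := hY.assoc' hR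
  exact ⟨X'', R, hX'''.isLE_mid (t.isLE_truncLT_obj _ _ _)
    (t.isLE_truncLT_obj _ _ _), hR'.prop_mid hV hU₃, hX''⟩

/-- After refining the roof by `exists_isLE`, its numerator is already zero in `C`. -/
lemma quotient_hom_eq_zero {X Y : C} (hX : t.IsLE X 0) (hY : t.IsGE Y 1)
    (f : K.trW.Q.obj X ⟶ K.trW.Q.obj Y) : f = 0 := by
  obtain ⟨φ, rfl⟩ := Localization.exists_rightFraction K.trW.Q K.trW f
  obtain ⟨U, a, b, hT, hU⟩ := (K.trW_iff' φ.s).1 φ.hs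
  obtain ⟨X'', R, hX'', hR, ⟨u, v, w, hT'⟩⟩ := hK.exists_isLE ⟨_, _, _, hT⟩ hU hX
  have : IsIso (K.trW.Q.map u) := Localization.inverts K.trW.Q K.trW u ⟨_, _, _, hT', hR⟩
  have h : K.trW.Q.map φ.f = 0 := by
    rw [← cancel_epi (K.trW.Q.map u), ← Functor.map_comp,
      t.zero_of_isLE_of_isGE (u ≫ φ.f) 0 1 (by lia) hX'' hY, Functor.map_zero, comp_zero]
  rw [MorphismProperty.RightFraction.map, h, comp_zero]

/-- The t-structure induced on a Verdier quotient. -/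
noncomputable def quotientTStructure : TStructure (VerdierQuotient K) where
  le n := (t.le n).map K.trW.Q
  ge n := (t.ge n).map K.trW.Q
  le_shift n a n' h Z hZ := by
    obtain ⟨X, hX, ⟨e⟩⟩ := (ObjectProperty.prop_map_iff _ _ _).1 hZ
    exact (ObjectProperty.prop_map_iff _ _ _).2 ⟨_, t.le_shift n a n' h X hX,
      ⟨(K.trW.Q.commShiftIso a).app X ≪≫ (shiftFunctor _ a).mapIso e⟩⟩
  ge_shift n a n' h Z hZ := by
    obtain ⟨X, hX, ⟨e⟩⟩ := (ObjectProperty.prop_map_iff _ _ _).1 hZ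
    exact (ObjectProperty.prop_map_iff _ _ _).2 ⟨_, t.ge_shift n a n' h X hX,
      ⟨(K.trW.Q.commShiftIso a).app X ≪≫ (shiftFunctor _ a).mapIso e⟩⟩
  zero' A B f hA hB := by
    obtain ⟨X, hX, ⟨e⟩⟩ := (ObjectProperty.prop_map_iff _ _ _).1 hA
    obtain ⟨Y, hY, ⟨e'⟩⟩ := (ObjectProperty.prop_map_iff _ _ _).1 hB
    rw [← cancel_epi e.hom, ← cancel_mono e'.inv, comp_zero, zero_comp]
    exact hK.quotient_hom_eq_zero ⟨hX⟩ ⟨hY⟩ _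
  le_zero_le := ObjectProperty.map_monotone t.le_zero_le _
  ge_one_le := ObjectProperty.map_monotone t.ge_one_le _
  exists_triangle_zero_one A := by
    have := Localization.essSurj K.trW.Q K.trW
    obtain ⟨X, Y, hX, hY, h⟩ := t.exists_triangle_zero_one (K.trW.Q.objPreimage A)
    obtain ⟨f, g, h, hT⟩ := (quotient_isExtension (K := K) h).congr (Iso.refl _)
      (K.trW.Q.objObjPreimageIso A) (Iso.refl _)
    exact ⟨_, _, ObjectProperty.prop_map_obj _ _ hX, ObjectProperty.prop_map_obj _ _ hY,
      f, g, h, hT⟩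

lemma descendsTo : DescendsTo t K hK.quotientTStructure := fun _ ↦ ⟨rfl, rfl⟩

lemma isBoundedTStructure_quotient (ht : IsBoundedTStructure t) :
    IsBoundedTStructure hK.quotientTStructure := by
  intro A
  have := Localization.essSurj K.trW.Q K.trW
  let e := K.trW.Q.objObjPreimageIso A
  obtain ⟨⟨a, ha⟩, ⟨b, hb⟩⟩ := ht (K.trW.Q.objPreimage A)
  exact ⟨⟨a, ⟨(ObjectProperty.prop_map_iff _ _ _).2 ⟨_, ha.ge, ⟨e⟩⟩⟩⟩,
    ⟨b, ⟨(ObjectProperty.prop_map_iff _ _ _).2 ⟨_, hb.le, ⟨e⟩⟩⟩⟩⟩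

/-- The two conditions on an object of the quotient may come from different representatives. For a
representative `X` in degrees `≤ 0`, the image of `τ^{<0} X` lies in degrees `≤ -1` and `≥ 0`, so it
vanishes and `τ^{≥0} X` represents the same object. -/
lemma heart_quotientTStructure : hK.quotientTStructure.heart = t.heart.map K.trW.Q := by
  ext A
  rw [ObjectProperty.prop_map_iff]
  constructor
  · rintro ⟨h₁, h₂⟩
    obtain ⟨X, hX, ⟨e⟩⟩ := (ObjectProperty.prop_map_iff _ _ _).1 h₁
    have hX' : t.IsLE X 0 := ⟨hX⟩
    have hT := quotient_isExtension (K := K) (isExtension_trunc t X 0)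
    have hQX : hK.quotientTStructure.IsGE (K.trW.Q.obj X) 0 :=
      ⟨ObjectProperty.prop_of_iso _ e.symm h₂⟩
    have hL : hK.quotientTStructure.IsLE (K.trW.Q.obj ((t.truncLT 0).obj X)) (-1) :=
      ⟨ObjectProperty.prop_map_obj _ _ (t.isLE_truncLT_obj X 0 (-1)).le⟩
    have hG : hK.quotientTStructure.IsGE (K.trW.Q.obj ((t.truncGE 0).obj X)) 0 :=
      ⟨ObjectProperty.prop_map_obj _ _ (t.isGE_truncGE_obj X 0 0).ge⟩
    have hL' := hT.isGE_left hQX (hK.quotientTStructure.isGE_of_ge _ (0 - 1) 0)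
    obtain ⟨e'⟩ := hT.iso_of_isZero_left (hK.quotientTStructure.isZero _ (-1) 0 (by lia))
    exact ⟨(t.truncGE 0).obj X, (t.mem_heart_iff _).2 ⟨inferInstance, inferInstance⟩,
      ⟨e'.symm ≪≫ e⟩⟩
  · rintro ⟨X, hX, ⟨e⟩⟩
    exact ⟨(ObjectProperty.prop_map_iff _ _ _).2 ⟨X, hX.1, ⟨e⟩⟩,
      (ObjectProperty.prop_map_iff _ _ _).2 ⟨X, hX.2, ⟨e⟩⟩⟩

end IsCompatible

end QuotientTStructure

/-! ### The heart as an abelian category and its Serre subcategories. -/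

section Hearts

variable {C : Type u} [Category.{v} C] [Preadditive C] [HasZeroObject C] [HasShift C ℤ]
  [∀ n : ℤ, (shiftFunctor C n).Additive] [Pretriangulated C] (t : TStructure C)

lemma heart_isExtension {X Y Z : C} (h : IsExtension X Y Z) (hX : t.heart X) (hZ : t.heart Z) :
    t.heart Y := by
  rw [t.mem_heart_iff] at *
  exact ⟨h.isLE_mid hX.1 hZ.1, h.isGE_mid hX.2 hZ.2⟩

lemma heart_of_isZero {X : C} (hX : IsZero X) : t.heart X :=
  (t.mem_heart_iff _).2 ⟨t.isLE_of_isZero hX 0, t.isGE_of_isZero hX 0⟩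

instance : t.heart.ContainsZero := ⟨0, isZero_zero C, heart_of_isZero t (isZero_zero C)⟩

instance : t.heart.IsClosedUnderBinaryProducts where
  limitsOfShape_le := by
    rintro X ⟨p⟩
    refine t.heart.prop_of_iso ?_ (heart_isExtension t (.of_distTriang
      (binaryProductTriangle_distinguished _ _)) (p.prop_diag_obj (.mk .left))
      (p.prop_diag_obj (.mk .right)))
    exact IsLimit.conePointUniqueUpToIso (prodIsProd _ _)
      ((IsLimit.postcomposeHomEquiv (diagramIsoPair p.diag) _).2 p.isLimit)

instance : t.heart.IsClosedUnderFiniteProducts := .mk'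

lemma hom_shift_eq_zero ⦃X Y : t.heart.FullSubcategory⦄ ⦃n : ℤ⦄
    (f : t.heart.ι.obj X ⟶ (t.heart.ι.obj Y)⟦n⟧) (hn : n < 0) : f = 0 :=
  t.zero_of_isLE_of_isGE f 0 (-n) (by lia) ⟨X.property.1⟩
    (have : t.IsGE Y.obj 0 := ⟨Y.property.2⟩
     t.isGE_shift Y.obj 0 n (-n))

variable [IsTriangulated C]

/-- The cone of a morphism in the heart lives in degrees `-1` and `0`; its truncation triangle
exhibits the kernel, shifted by `1`, and the cokernel. -/
lemma admissibleMorphism_eq_top :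
    AbelianSubcategory.admissibleMorphism t.heart.ι = ⊤ := by
  refine top_unique fun X Y f _ X₃ f₂ f₃ hT ↦ ?_
  have h : IsExtension (t.heart.ι.obj Y) X₃ ((t.heart.ι.obj X)⟦(1 : ℤ)⟧) :=
    ⟨_, _, _, rot_of_distTriang _ hT⟩
  have : t.IsLE (t.heart.ι.obj X) 0 := ⟨X.property.1⟩
  have : t.IsGE (t.heart.ι.obj X) 0 := ⟨X.property.2⟩
  have : t.IsLE (t.heart.ι.obj Y) 0 := ⟨Y.property.1⟩
  have : t.IsGE (t.heart.ι.obj Y) 0 := ⟨Y.property.2⟩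
  have : t.IsLE ((t.heart.ι.obj X)⟦(1 : ℤ)⟧) (-1) := t.isLE_shift _ 0 1 (-1)
  have : t.IsLE X₃ 0 := h.isLE_mid inferInstance (t.isLE_of_le _ (-1) 0)
  have : t.IsGE X₃ (-1) := h.isGE_mid (t.isGE_of_ge _ _ 0) (t.isGE_shift _ 0 1 (-1))
  have : t.IsLE ((t.truncLT 0).obj X₃) (-1) := t.isLE_truncLT_obj _ _ _
  have hL : t.heart (((t.truncLT 0).obj X₃)⟦(-1 : ℤ)⟧) := (t.mem_heart_iff _).2
    ⟨t.isLE_shift _ (-1) (-1) 0, t.isGE_shift _ (-1) (-1) 0⟩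
  have hQ : t.heart ((t.truncGE 0).obj X₃) :=
    (t.mem_heart_iff _).2 ⟨inferInstance, inferInstance⟩
  obtain ⟨α, β, γ, hT'⟩ := (isExtension_trunc t X₃ 0).congr
    (shiftNegShift ((t.truncLT 0).obj X₃) (1 : ℤ)).symm (Iso.refl _) (Iso.refl _)
  exact ⟨⟨_, hL⟩, ⟨_, hQ⟩, α, β, γ, hT'⟩

/-- The heart of a t-structure is an abelian category. -/
@[reducible]
noncomputable def abelianHeart : Abelian t.heart.FullSubcategory :=
  AbelianSubcategory.abelian t.heart.ι (hom_shift_eq_zero t) (admissibleMorphism_eq_top t)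

/-- An epimorphism of the heart completes to a triangle whose first vertex is its kernel, and
kernels are unique up to isomorphism. -/
lemma isExtension_of_shortExact {S : ShortComplex t.heart.FullSubcategory}
    (hS : letI := abelianHeart t; S.ShortExact) :
    IsExtension S.X₁.obj S.X₂.obj S.X₃.obj := by
  let := abelianHeart t
  have := hS.epi_g
  obtain ⟨I, i, δ, hT⟩ := AbelianSubcategory.exists_distinguished_triangle_of_epi
    (hom_shift_eq_zero t) (admissibleMorphism_eq_top t) S.g
  let e := IsLimit.conePointUniqueUpToIso
    (AbelianSubcategory.isLimitKernelForkOfDistTriang (hom_shift_eq_zero t) _ _ _ hT) hS.fIsKernel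
  exact IsExtension.congr ⟨_, _, _, hT⟩ (t.heart.ι.mapIso e) (Iso.refl _) (Iso.refl _)

lemma isSerreClass_heart (K : ObjectProperty C) [K.IsTriangulated] [K.IsClosedUnderIsomorphisms]
    (hK : ∀ {X Y Z : C}, IsExtension X Y Z → t.heart X → t.heart Z → K Y → K X ∧ K Z) :
    letI := abelianHeart t
    (K.inverseImage t.heart.ι).IsSerreClass := by
  let := abelianHeart t
  have key {S : ShortComplex t.heart.FullSubcategory} (hS : S.ShortExact) (h : K S.X₂.obj) :
      K S.X₁.obj ∧ K S.X₃.obj :=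
    hK (isExtension_of_shortExact t hS) S.X₁.property S.X₃.property h
  exact
    { exists_zero := by
        obtain ⟨Z, hZ, hKZ⟩ := K.exists_prop_of_containsZero
        exact ⟨⟨Z, heart_of_isZero t hZ⟩, (IsZero.iff_id_eq_zero _).2
          (t.heart.ι.map_injective (hZ.eq_of_src _ _)), hKZ⟩
      prop_of_mono := fun f hf hY ↦
        (key (S := ShortComplex.mk f (cokernel.π f) (by simp)) 
          { exact := ShortComplex.exact_cokernel f, mono_f := hf, epi_g := inferInstance} hY).1
      prop_of_epi := fun f hf hX ↦
        (key (S := ShortComplex.mk (kernel.ι f) f (by simp)) 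
          { exact := ShortComplex.exact_kernel f, mono_f := inferInstance, epi_g := hf} hX).2
      prop_X₂_of_shortExact := fun hS h₁ h₃ ↦ (isExtension_of_shortExact t hS).prop_mid h₁ h₃ }

end Hearts

end DegStab

/-! ### Assembly of the three statements. -/

theorem mainTheorem4
    {C : Type u} [Category.{v} C] [Preadditive C] [HasZeroObject C] [HasShift C ℤ]
    [∀ n : ℤ, (shiftFunctor C n).Additive] [Pretriangulated C] [IsTriangulated C]
    {Λ : Type w} [AddCommGroup Λ] [Module.Free ℤ Λ] [Module.Finite ℤ Λ]
    (p : DegStab.GrothendieckGroup C →+ Λ) (hp : Function.Surjective p)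
    (g : InnerProductSpace.Core ℝ (Λ →+ ℂ))
    (σ : ℕ → DegStab.StabilityCondition p) (hσ : DegStab.IsCauchySequence g σ) :
    (∀ T ∈ distTriang C, DegStab.limitHeart σ T.obj₁ → DegStab.limitHeart σ T.obj₂ →
      DegStab.limitHeart σ T.obj₃ →
      (DegStab.massless σ T.obj₂ ↔ DegStab.massless σ T.obj₁ ∧ DegStab.massless σ T.obj₃)) ∧
    ((∃ S : DegStab.Slicing C, S.P = DegStab.limitPhase σ) →
      ∃ t : TStructure C, DegStab.IsBoundedTStructure t ∧ t.heart = DegStab.limitHeart σ) ∧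
    ∃ _ : (DegStab.massless σ).IsTriangulated,
      ∀ t : TStructure C, DegStab.IsBoundedTStructure t → t.heart = DegStab.limitHeart σ →
        (∃ _ : Abelian (DegStab.limitHeart σ).FullSubcategory,
          ((DegStab.massless σ).inverseImage (DegStab.limitHeart σ).ι).IsSerreClass) ∧
        ∃ t' : TStructure (DegStab.VerdierQuotient (DegStab.massless σ)),
          DegStab.DescendsTo t (DegStab.massless σ) t' ∧
          DegStab.IsBoundedTStructure t' ∧
          t'.heart = (DegStab.limitHeart σ).map (DegStab.massless σ).trW.Q := by
  refine ⟨fun T hT h₁ _ h₃ ↦ ⟨DegStab.massless_of_heart (.of_distTriang hT) h₁ h₃,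
    fun h ↦ DegStab.massless_of_isExtension (.of_distTriang hT) h.1 h.2⟩, ?_,
    DegStab.isTriangulated_massless, fun t ht hA ↦ ?_⟩
  · rintro ⟨S, hS⟩
    refine ⟨S.tStructure 0, S.isBoundedTStructure 0, ?_⟩
    rw [S.heart_tStructure, DegStab.limitHeart, hS, zero_add]
  · have hK : DegStab.IsCompatible t (DegStab.massless σ) :=
      ⟨DegStab.massless_of_truncation ht hA, fun h h₁ h₃ h₂ ↦
        (DegStab.massless_of_heart h (hA ▸ h₁) (hA ▸ h₃) h₂).2⟩
    refine ⟨?_, hK.quotientTStructure, hK.descendsTo, hK.isBoundedTStructure_quotient ht, ?_⟩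
    · have H := DegStab.isSerreClass_heart t (DegStab.massless σ) fun h h₁ h₃ h₂ ↦
        DegStab.massless_of_heart h (hA ▸ h₁) (hA ▸ h₃) h₂
      rw [← hA]
      exact ⟨_, H⟩
    · rw [hK.heart_quotientTStructure, hA]
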